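/- For a positive integer $n$ and a real number $X \ge 1$, let $\operatorname{M}_n(\mathbb{Z})_{\mathrm{alt},\le X}$ be the finite set of integer $n\times n$ matrices $A$ with $A^T=-A$ all of whose entries have absolute value at most $X$. For every $n \ge 1$ there exist constants $c_n, C_n > 0$, depending only on $n$, such that for every integer $r$ with $1 \le r \le n$ and $n-r$ even, and every real number $X \ge 1$, if $A$ is chosen uniformly at random from $\operatorname{M}_n(\mathbb{Z})_{\mathrm{alt},\le X}$, then $$c_n\,(X^n)^{-(r-1)/2} \;\le\; \operatorname{Prob}\bigl(\operatorname{rk}_{\mathbb{Z}}(\ker A) \ge r\bigr) \;\le\; C_n\,(X^n)^{-(r-1)/2},$$ where $\ker A$ is the kernel of $A$ acting on $\mathbb{Z}^n$ and $\operatorname{rk}_{\mathbb{Z}}$ denotes its rank as a free abelian group. -/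

import Mathlib

/-- The set of integer alternating `n × n` matrices (`Aᵀ = -A`, which over `ℤ` forces a zero
diagonal) all of whose entries have absolute value at most `X`. -/
def altMatricesLE (n : ℕ) (X : ℝ) : Set (Matrix (Fin n) (Fin n) ℤ) :=
  {A | A.transpose = -A ∧ ∀ i j, |(A i j : ℝ)| ≤ X}

theorem altMatricesLE_finite (n : ℕ) (X : ℝ) : (altMatricesLE n X).Finite := by
  have : ({A | ∀ i j, A i j ∈ Set.Icc (-⌊X⌋) ⌊X⌋} : Set (Fin n → Fin n → ℤ)).Finite :=
    Set.Finite.pi' (fun _ => Set.Finite.pi' fun _ => Set.finite_Icc _ _)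
  refine this.subset ?_
  intro A hA i j
  have h := abs_le.1 (hA.2 i j)
  refine ⟨?_, Int.le_floor.2 h.2⟩
  have : -(A i j) ≤ ⌊X⌋ := Int.le_floor.2 (by push_cast; linarith)
  linarith

theorem altMatricesLE_nonempty (n : ℕ) {X : ℝ} (hX : 0 ≤ X) : (altMatricesLE n X).Nonempty :=
  ⟨0, by simp, by simpa using fun _ _ => hX⟩

/-- The rank, as a free `ℤ`-module, of the kernel of the endomorphism `v ↦ A v` of `ℤⁿ`. -/
noncomputable def kerRank {n : ℕ} (A : Matrix (Fin n) (Fin n) ℤ) : ℕ :=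
  Module.finrank ℤ (LinearMap.ker A.mulVecLin)

/-- The probability that an element of `S`, chosen uniformly at random, satisfies `P`
(meaningful for `S` finite and nonempty). -/
noncomputable def uniformProb {α : Type*} (S : Set α) (P : α → Prop) : ℝ :=
  ({a ∈ S | P a}.ncard : ℝ) / (S.ncard : ℝ)

/-! Write `n = r + 2k`. The event says that `A` has rank at most `2k`. Alternating matrices of
height `X` number about `X ^ (n(n-1)/2)`, and `nk - n(n-1)/2 = -n(r-1)/2`, so it suffices to show
that those of rank at most `2k` number `X ^ (nk)` up to constants (`exists_ncard_kerRank_le`,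
`exists_le_ncard_kerRank`).

Upper bound (`exists_card_forms_le`). The count is carried out for skew operators `T` integral on a
lattice `M`, by induction on `k`. Let `v` be a shortest dual-lattice vector in the range of `T`.
Compressing `T` to the hyperplane orthogonal to `v` lowers the rank by at least 2 and keeps
skewness, integrality and the norm bound. The projection of the dual lattice to the hyperplane is
denser by a factor `‖v‖` (`CountBound.slice`), and the operators with a given compression correspond
to its points in a ball of radius about `X / ‖v‖` (`card_fiber_compress_le`). Since `‖v‖ ^ 2` is at
most a constant times `X` (`IsShortest.norm_sq_le`), the resulting sum over `v` is dominated by its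
longest vectors (`CountBound.sum_le`), which gives the exponent `nk`.

Lower bound. The matrices `Bᵀ J B`, with `J` a nondegenerate alternating matrix of size `2k` and `B`
of size `2k × n` with entries of order `√X`, have rank at most `2k`, and there are about `X ^ (nk)`
choices of `B`. Repetitions must be bounded. If the rows of `B` are independent modulo every prime,
any `B'` giving the same form is `g B` with `g` integral; taking the leading blocks diagonally
dominant bounds the entries of `g` (`exists_mul_eq_of_form_eq`). A sieve adding one row at a time
shows that a positive proportion of the `B` qualify (`pow_le_card_rowsUnimodular`). It works because
`2k < n`: each new row must avoid a subspace of codimension at least 2 modulo `p`, and the sum of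
`p⁻²` converges. -/

open Module

/-! ### Alternating forms on lattices and their compression to a hyperplane. -/

section LatticeForms

/-- Balls of radius `ρ ≥ 1` contain at most `D ρ ^ n` points of `S`. -/
def CountBound {E : Type} [NormedAddCommGroup E] (S : Set E) (n : ℕ) (D : ℝ) : Prop :=
  ∀ (x : E) (ρ : ℝ), 1 ≤ ρ → ∀ P : Finset E, (∀ y ∈ P, y ∈ S ∧ ‖y - x‖ ≤ ρ) →
    (P.card : ℝ) ≤ D * ρ ^ n

variable {E : Type} [NormedAddCommGroup E] [InnerProductSpace ℝ E]

/-- The vectors having integral inner product with every element of `M`. -/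
def dualLattice (M : AddSubgroup E) : AddSubgroup E where
  carrier := {x | ∀ m ∈ M, ∃ z : ℤ, inner ℝ x m = z}
  zero_mem' := fun m _ => ⟨0, by simp⟩
  add_mem' := by
    intro a b ha hb m hm
    obtain ⟨z, hz⟩ := ha m hm
    obtain ⟨w, hw⟩ := hb m hm
    exact ⟨z + w, by rw [inner_add_left, hz, hw]; push_cast; rfl⟩
  neg_mem' := by
    intro a ha m hm
    obtain ⟨z, hz⟩ := ha m hm
    exact ⟨-z, by rw [inner_neg_left, hz]; push_cast; rfl⟩

theorem add_intCast_smul_mem {L : AddSubgroup E} {x v : E} (hx : x ∈ L) (hv : v ∈ L) (z : ℤ) :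
    x + (z : ℝ) • v ∈ L := by
  rw [Int.cast_smul_eq_zsmul]
  exact L.add_mem hx (L.zsmul_mem hv z)

/-- A skew endomorphism whose associated alternating form is integral on `M`. -/
structure IsLatticeForm (M : AddSubgroup E) (T : E →ₗ[ℝ] E) : Prop where
  skew : ∀ x y, inner ℝ (T x) y = -inner ℝ x (T y)
  integral : ∀ x ∈ M, T x ∈ dualLattice M

/-- `v` is a shortest nonzero vector of the dual lattice in the range of `T`. -/
structure IsShortest (M : AddSubgroup E) (T : E →ₗ[ℝ] E) (v : E) : Prop where
  mem : v ∈ dualLattice M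
  mem_range : v ∈ LinearMap.range T
  ne_zero : v ≠ 0
  le : ∀ u ∈ dualLattice M, u ∈ LinearMap.range T → u ≠ 0 → ‖v‖ ≤ ‖u‖

/-- The hyperplane orthogonal to `v`. -/
noncomputable abbrev perp (v : E) : Submodule ℝ E := (ℝ ∙ v)ᗮ

/-- The part of `M` orthogonal to `v`. -/
noncomputable def sliceLattice (M : AddSubgroup E) (v : E) : AddSubgroup (perp v) :=
  M.comap (perp v).subtype.toAddMonoidHom

/-- The compression of `T` to the hyperplane orthogonal to `v`. -/
noncomputable def compress (v : E) (T : E →ₗ[ℝ] E) : perp v →ₗ[ℝ] perp v :=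
  (perp v).orthogonalProjectionOnto.toLinearMap ∘ₗ T ∘ₗ (perp v).subtype

theorem coe_proj (v x : E) : ((perp v).orthogonalProjectionOnto x : E) =
    x - (inner ℝ v x / ‖v‖ ^ 2) • v := by
  have h := Submodule.starProjection_orthogonal_val (K := ℝ ∙ v) x
  rw [Submodule.starProjection_apply] at h
  rw [h, Submodule.starProjection_singleton]
  simp

theorem coe_compress (v : E) (T : E →ₗ[ℝ] E) (x : perp v) : (compress v T x : E) =
    T x - (inner ℝ v (T x) / ‖v‖ ^ 2) • v := coe_proj v _

theorem inner_perp {v : E} (x : perp v) : inner ℝ v (x : E) = 0 :=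
  Submodule.mem_orthogonal_singleton_iff_inner_right.1 x.2

theorem inner_perp' {v : E} (x : perp v) : inner ℝ (x : E) v = 0 :=
  Submodule.mem_orthogonal_singleton_iff_inner_left.1 x.2

variable {M : AddSubgroup E} {T : E →ₗ[ℝ] E} {v : E}

theorem IsLatticeForm.inner_self (h : IsLatticeForm M T) (x : E) : inner ℝ (T x) x = 0 := by
  have := h.skew x x
  rw [real_inner_comm x (T x)] at this
  rw [real_inner_comm]
  linarith

theorem exists_mem_inner_ne_zero (hM : Submodule.span ℝ (M : Set E) = ⊤) (hv : v ≠ 0) :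
    ∃ b ∈ M, inner ℝ v b ≠ 0 := by
  by_contra! h
  have : Submodule.span ℝ (M : Set E) ≤ perp v := by
    rw [Submodule.span_le]
    intro b hb
    exact Submodule.mem_orthogonal_singleton_iff_inner_right.2 (h b hb)
  rw [hM] at this
  have h2 : v ∈ perp v := this trivial
  exact hv (inner_self_eq_zero.1 (Submodule.mem_orthogonal_singleton_iff_inner_right.1 h2))

/-- The values of `⟨v, ·⟩` on `M` form a subgroup `dℤ` with `d ≠ 0`. Then `d⁻¹ v` is still dual and
in the range, so minimality of `v` forces `|d| = 1`. -/
theorem IsShortest.exists_inner_eq_one (hM : Submodule.span ℝ (M : Set E) = ⊤)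
    (hv : IsShortest M T v) : ∃ b ∈ M, inner ℝ v b = 1 := by
  let I : AddSubgroup ℤ :=
    { carrier := {z | ∃ b ∈ M, inner ℝ v b = z}
      zero_mem' := ⟨0, M.zero_mem, by simp⟩
      add_mem' := by
        rintro a b ⟨x, hx, hx'⟩ ⟨y, hy, hy'⟩
        exact ⟨x + y, M.add_mem hx hy, by rw [inner_add_right, hx', hy']; push_cast; rfl⟩
      neg_mem' := by
        rintro a ⟨x, hx, hx'⟩
        exact ⟨-x, M.neg_mem hx, by rw [inner_neg_right, hx']; push_cast; rfl⟩ }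
  obtain ⟨d, hd⟩ := Int.subgroup_cyclic I
  have hI : ∀ z : ℤ, z ∈ I ↔ d ∣ z := by
    intro z
    rw [hd, AddSubgroup.mem_closure_singleton]
    constructor
    · rintro ⟨k, rfl⟩
      exact ⟨k, by simp [mul_comm]⟩
    · rintro ⟨k, rfl⟩
      exact ⟨k, by simp [mul_comm]⟩
  obtain ⟨b₀, hb₀, hb₀'⟩ := exists_mem_inner_ne_zero hM hv.ne_zero
  have hd0 : d ≠ 0 := by
    rintro rfl
    obtain ⟨z, hz⟩ := hv.mem b₀ hb₀
    have : z ∈ I := ⟨b₀, hb₀, hz⟩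
    rw [hI, zero_dvd_iff] at this
    exact hb₀' (by rw [hz, this]; simp)
  have hdR : (d : ℝ) ≠ 0 := by exact_mod_cast hd0
  have hmem : (d : ℝ)⁻¹ • v ∈ dualLattice M := by
    intro m hm
    obtain ⟨z, hz⟩ := hv.mem m hm
    obtain ⟨k, hk⟩ := (hI z).1 ⟨m, hm, hz⟩
    refine ⟨k, ?_⟩
    rw [inner_smul_left, hz, hk]
    simp [hdR]
  have hle := hv.le _ hmem (Submodule.smul_mem _ _ hv.mem_range)
    (smul_ne_zero (inv_ne_zero hdR) hv.ne_zero)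
  rw [norm_smul, norm_inv, Real.norm_eq_abs] at hle
  have hvpos : 0 < ‖v‖ := norm_pos_iff.2 hv.ne_zero
  have habs : 0 < |(d : ℝ)| := abs_pos.2 hdR
  have h1 : |(d : ℝ)| ≤ 1 := by
    rw [inv_mul_eq_div, le_div_iff₀ habs] at hle
    nlinarith
  have h2 : |d| ≤ 1 := by exact_mod_cast h1
  have hone : (1 : ℤ) ∈ I := by
    rw [hI]
    rcases abs_le.1 h2 with ⟨h3, h4⟩
    have : d = 1 ∨ d = -1 := by omega
    rcases this with rfl | rfl <;> norm_num
  obtain ⟨b, hb, hb'⟩ := hone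
  exact ⟨b, hb, by simpa using hb'⟩

/-- Since `⟨v, b⟩ = 1`, `M` splits as `ℤ b` plus its slice, and a functional integral on the slice
extends to `M` by zero on `b`. Hence the dual of the slice lies in the projection of the dual of
`M`. -/
theorem lift_mem_dualLattice {b : E} (hb : b ∈ M) (hvb : inner ℝ v b = 1)
    (hv : v ∈ dualLattice M)
    {y : perp v} (hy : y ∈ dualLattice (sliceLattice M v)) :
    (y : E) - (inner ℝ (y : E) b : ℝ) • v ∈ dualLattice M := by
  intro x hx
  obtain ⟨z, hz⟩ := hv x hx
  have h1 : x - (z : ℝ) • b ∈ perp v := by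
    rw [Submodule.mem_orthogonal_singleton_iff_inner_right, inner_sub_right, inner_smul_right,
      hvb, hz]
    ring
  have h2 : x - (z : ℝ) • b ∈ M := by
    rw [Int.cast_smul_eq_zsmul]
    exact M.sub_mem hx (M.zsmul_mem hb z)
  obtain ⟨w, hw⟩ := hy ⟨_, h1⟩ h2
  refine ⟨w, ?_⟩
  rw [← hw, Submodule.coe_inner, inner_sub_left, inner_sub_right, inner_smul_left,
    inner_smul_right, hz]
  simp
  ring

/-- The map `x ↦ ⟨v, b⟩ x - ⟨v, x⟩ b` sends `M` into the slice and is multiplication by a nonzero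
scalar on the hyperplane. -/
theorem span_sliceLattice (hM : Submodule.span ℝ (M : Set E) = ⊤) (hv : v ∈ dualLattice M)
    (hv0 : v ≠ 0) :
    Submodule.span ℝ (sliceLattice M v : Set (perp v)) = ⊤ := by
  obtain ⟨b, hb, hvb⟩ := exists_mem_inner_ne_zero hM hv0
  let f : E →ₗ[ℝ] E := (inner ℝ v b : ℝ) • LinearMap.id - (innerₛₗ ℝ v).smulRight b
  have hf : ∀ x, f x = (inner ℝ v b : ℝ) • x - (inner ℝ v x : ℝ) • b := fun x => by
    simp [f]
  have key : ∀ x : E, f x ∈ (Submodule.span ℝ (sliceLattice M v : Set (perp v))).map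
      (perp v).subtype := by
    have : (⊤ : Submodule ℝ E) ≤ ((Submodule.span ℝ (sliceLattice M v : Set (perp v))).map
        (perp v).subtype).comap f := by
      rw [← hM, Submodule.span_le]
      intro x hx
      obtain ⟨p, hp⟩ := hv b hb
      obtain ⟨q, hq⟩ := hv x hx
      have h1 : f x ∈ perp v := by
        rw [Submodule.mem_orthogonal_singleton_iff_inner_right, hf, inner_sub_right,
          inner_smul_right, inner_smul_right]
        ring
      have h2 : f x ∈ M := by
        rw [hf, hp, hq, Int.cast_smul_eq_zsmul, Int.cast_smul_eq_zsmul]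
        exact M.sub_mem (M.zsmul_mem hx _) (M.zsmul_mem hb _)
      exact ⟨⟨f x, h1⟩, Submodule.subset_span h2, rfl⟩
    exact fun x => this trivial
  rw [eq_top_iff]
  rintro x -
  obtain ⟨y, hy, hyx⟩ := key x
  have : y = (inner ℝ v b : ℝ) • x := by
    apply Subtype.ext
    rw [hf, inner_perp x] at hyx
    simpa using hyx
  rw [this] at hy
  simpa [smul_smul, inv_mul_cancel₀ hvb] using Submodule.smul_mem _ (inner ℝ v b : ℝ)⁻¹ hy

theorem inner_compress (x y : perp v) :
    inner ℝ (compress v T x) y = inner ℝ (T x) (y : E) := by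
  rw [Submodule.coe_inner, coe_compress, inner_sub_left, inner_smul_left, inner_perp y]
  simp

/-- The compression represents the restriction of the form `⟨T x, y⟩` to the hyperplane. -/
theorem IsLatticeForm.isLatticeForm_compress (h : IsLatticeForm M T) :
    IsLatticeForm (sliceLattice M v) (compress v T) where
  skew x y := by
    rw [inner_compress, real_inner_comm (compress v T y) x, inner_compress, h.skew,
      real_inner_comm (T y)]
  integral x hx m hm := by
    rw [inner_compress]
    exact h.integral _ hx _ hm

theorem norm_compress_le {X : ℝ} (hX : ∀ x, ‖T x‖ ≤ X * ‖x‖) (x : perp v) :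
    ‖compress v T x‖ ≤ X * ‖x‖ :=
  ((perp v).norm_orthogonalProjectionOnto_apply_le _).trans (hX x)

theorem range_compress_le (hv : v ∈ LinearMap.range T) {y : perp v}
    (hy : y ∈ LinearMap.range (compress v T)) : (y : E) ∈ LinearMap.range T := by
  obtain ⟨x, rfl⟩ := hy
  rw [coe_compress]
  exact Submodule.sub_mem _ ⟨_, rfl⟩ (Submodule.smul_mem _ _ hv)

theorem norm_sq_add_smul (y : perp v) (c : ℝ) :
    ‖(y : E) + c • v‖ ^ 2 = ‖y‖ ^ 2 + c ^ 2 * ‖v‖ ^ 2 := by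
  rw [@norm_add_sq_real, inner_smul_right, inner_perp', norm_smul, mul_pow]
  simp

/-- A vector of the quotient lattice supported on the range is not much shorter than `v`. -/
theorem IsShortest.norm_le_of_lift (hv : IsShortest M T v) {y : perp v} (hy : y ≠ 0)
    {a : ℝ} (ha : (y : E) + a • v ∈ dualLattice M) (hr : (y : E) ∈ LinearMap.range T) :
    3 * ‖v‖ ^ 2 ≤ 4 * ‖y‖ ^ 2 := by
  -- Subtracting the nearest integer multiple of `v` leaves a coefficient of size at most 1/2, so
  -- minimality gives `‖v‖² ≤ ‖y‖² + ‖v‖² / 4`.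
  have h1 := add_intCast_smul_mem ha hv.mem (-round a)
  have h2 : (y : E) + a • v + ((-round a : ℤ) : ℝ) • v = (y : E) + (a - round a) • v := by
    push_cast; module
  rw [h2] at h1
  have h3 : (y : E) + (a - round a) • v ≠ 0 := by
    intro h0
    have := norm_sq_add_smul y (a - round a)
    rw [h0, norm_zero] at this
    have hpos : 0 < ‖y‖ := norm_pos_iff.2 hy
    have : 0 < ‖y‖ ^ 2 := by positivity
    nlinarith [mul_nonneg (sq_nonneg (a - round a)) (sq_nonneg ‖v‖)]
  have h4 := hv.le _ h1 (Submodule.add_mem _ hr (Submodule.smul_mem _ _ hv.mem_range)) h3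
  have h5 : ‖v‖ ^ 2 ≤ ‖y‖ ^ 2 + (a - round a) ^ 2 * ‖v‖ ^ 2 := by
    rw [← norm_sq_add_smul]
    gcongr
  have h6 : (a - round a) ^ 2 ≤ 1 / 4 := by
    have := abs_sub_round a
    rw [← sq_abs]
    nlinarith [abs_nonneg (a - round a)]
  nlinarith [mul_le_mul_of_nonneg_right h6 (sq_nonneg ‖v‖)]

theorem IsShortest.le_of_mem_compress (hM : Submodule.span ℝ (M : Set E) = ⊤)
    (hv : IsShortest M T v) {y : perp v} (hy : y ≠ 0)
    (hd : y ∈ dualLattice (sliceLattice M v)) (hr : y ∈ LinearMap.range (compress v T)) :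
    3 * ‖v‖ ^ 2 ≤ 4 * ‖y‖ ^ 2 := by
  obtain ⟨b, hb, hvb⟩ := hv.exists_inner_eq_one hM
  have := lift_mem_dualLattice hb hvb hv.mem hd
  rw [sub_eq_add_neg, ← neg_smul] at this
  exact hv.norm_le_of_lift hy this (range_compress_le hv.mem_range hr)

/-- Write `v = T u`. By skewness both `ker T` and `u` lie in the hyperplane, and the compression
kills both. The kernel grows while the space loses a dimension, so the rank drops by at least 2. -/
theorem IsLatticeForm.finrank_ker_compress [FiniteDimensional ℝ E] (h : IsLatticeForm M T)
    (hv0 : v ≠ 0) (hv : v ∈ LinearMap.range T) :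
    finrank ℝ (LinearMap.ker T) + 1 ≤ finrank ℝ (LinearMap.ker (compress v T)) := by
  obtain ⟨u, rfl⟩ := hv
  have hu : u ∉ LinearMap.ker T := hv0
  have hle : LinearMap.ker T ⊔ (ℝ ∙ u) ≤
      (LinearMap.ker (compress (T u) T)).map (perp (T u)).subtype := by
    rw [sup_le_iff]
    constructor
    · intro x hx
      have hx' : x ∈ perp (T u) := by
        rw [Submodule.mem_orthogonal_singleton_iff_inner_right, h.skew,
          LinearMap.mem_ker.1 hx, inner_zero_right, neg_zero]
      refine ⟨⟨x, hx'⟩, ?_, rfl⟩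
      apply LinearMap.mem_ker.2
      apply Subtype.ext
      rw [coe_compress]
      simp [LinearMap.mem_ker.1 hx]
    · rw [Submodule.span_singleton_le_iff_mem]
      have hx' : u ∈ perp (T u) := by
        rw [Submodule.mem_orthogonal_singleton_iff_inner_right, h.inner_self]
      refine ⟨⟨u, hx'⟩, ?_, rfl⟩
      apply LinearMap.mem_ker.2
      apply Subtype.ext
      rw [coe_compress]
      have : ‖T u‖ ≠ 0 := norm_ne_zero_iff.2 hv0
      simp [this]
  have h1 := Submodule.finrank_mono hle
  rwa [Submodule.finrank_map_subtype_eq, Submodule.finrank_sup_span_singleton hu] at h1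

end LatticeForms

/-! ### Counting lattice points; existence of shortest vectors; density of the quotient lattice. -/

section LatticeForms

theorem CountBound.finite {E : Type} [NormedAddCommGroup E] {S : Set E} {n : ℕ} {D : ℝ}
    (h : CountBound S n D) (R : ℝ) :
    {y ∈ S | ‖y‖ ≤ R}.Finite := by
  by_contra hinf
  obtain ⟨N, hN⟩ := exists_nat_gt (D * (max 1 R) ^ n)
  obtain ⟨P, hP, hcard⟩ := Set.Infinite.exists_subset_card_eq hinf N
  have := h 0 (max 1 R) (le_max_left _ _) P (fun y hy => by
    have := hP hy
    exact ⟨this.1, by rw [sub_zero]; exact this.2.trans (le_max_right _ _)⟩)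
  rw [hcard] at this
  linarith

theorem CountBound.one_le {E : Type} [NormedAddCommGroup E] {L : AddSubgroup E} {n : ℕ} {D : ℝ}
    (h : CountBound (L : Set E) n D) : 1 ≤ D := by
  have := h 0 1 le_rfl {0} (by simp [L.zero_mem])
  simpa using this

/-- The weighted count of lattice vectors, dominated by the longest ones. -/
theorem CountBound.sum_le {E : Type} [NormedAddCommGroup E] {S : Set E} {n q : ℕ} {D δ : ℝ}
    (h : CountBound S n D) (hD : 0 ≤ D)
    (hq : 1 ≤ q) (hδ : 0 < δ) (hδ1 : δ ≤ 1) (J : ℕ) :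
    ∀ R : ℝ, 0 ≤ R → R < 2 ^ J * δ → ∀ V : Finset E, (∀ v ∈ V, v ∈ S ∧ δ ≤ ‖v‖ ∧ ‖v‖ ≤ R) →
      ∑ v ∈ V, ‖v‖ ^ q / ‖v‖ ^ n ≤ 2 ^ (n + 1) / δ ^ n * D * R ^ q := by
  classical
  induction J with
  | zero =>
    intro R hR₀ hR V hV
    have : V = ∅ := by
      apply Finset.eq_empty_of_forall_notMem
      intro v hv
      have := hV v hv
      simp only [pow_zero, one_mul] at hR
      linarith [this.2.1, this.2.2]
    rw [this, Finset.sum_empty]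
    positivity
  | succ J ih =>
    intro R hR₀ hR V hV
    rcases V.eq_empty_or_nonempty with rfl | ⟨v₀, hv₀⟩
    · rw [Finset.sum_empty]
      positivity
    have hRδ : δ ≤ R := (hV v₀ hv₀).2.1.trans (hV v₀ hv₀).2.2
    have hR0 : 0 < R := by linarith
    rw [← Finset.sum_filter_add_sum_filter_not V (fun v => ‖v‖ ≤ R / 2)]
    have h1 := ih (R / 2) (by positivity) (by rw [pow_succ] at hR; linarith)
      (V.filter (fun v => ‖v‖ ≤ R / 2))
      (fun v hv => by
        rw [Finset.mem_filter] at hv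
        exact ⟨(hV v hv.1).1, (hV v hv.1).2.1, hv.2⟩)
    have h2 : ∑ v ∈ V with ¬ ‖v‖ ≤ R / 2, ‖v‖ ^ q / ‖v‖ ^ n ≤
        (D * (R / δ) ^ n) * (R ^ q / (R / 2) ^ n) := by
      -- The radius is `R / δ`, not `R`, because the count needs a radius at least 1.
      have hc := h 0 (R / δ) (by rwa [one_le_div hδ]) (V.filter (fun v => ¬ ‖v‖ ≤ R / 2))
        (fun v hv => by
          rw [Finset.mem_filter] at hv
          refine ⟨(hV v hv.1).1, ?_⟩
          rw [sub_zero]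
          refine (hV v hv.1).2.2.trans ?_
          rw [le_div_iff₀ hδ]
          nlinarith)
      refine (Finset.sum_le_card_nsmul _ _ (R ^ q / (R / 2) ^ n) ?_).trans ?_
      · intro v hv
        rw [Finset.mem_filter, not_le] at hv
        have := (hV v hv.1).2.2
        have := hv.2
        gcongr
      · rw [nsmul_eq_mul]
        gcongr
    -- Here `1 ≤ q` makes the dyadic shells sum geometrically: the ball of radius `R / 2` uses half
    -- of the bound, the outer shell the other half.
    have h3 : (R / 2) ^ q ≤ R ^ q / 2 := by
      rw [div_pow]
      gcongr
      calc (2 : ℝ) = 2 ^ 1 := by norm_num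
        _ ≤ 2 ^ q := pow_le_pow_right₀ (by norm_num) hq
    have h4 : (D * (R / δ) ^ n) * (R ^ q / (R / 2) ^ n) = 2 ^ (n + 1) / δ ^ n * D * (R ^ q / 2) := by
      rw [div_pow, div_pow, pow_succ]
      field_simp
    have h5 : 2 ^ (n + 1) / δ ^ n * D * (R / 2) ^ q ≤ 2 ^ (n + 1) / δ ^ n * D * (R ^ q / 2) := by
      gcongr
    linarith

variable {E : Type} [NormedAddCommGroup E] [InnerProductSpace ℝ E]
variable {M : AddSubgroup E} {T : E →ₗ[ℝ] E} {v : E}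

/-- Some `T m` with `m ∈ M` is a nonzero candidate, and only finitely many dual vectors are as
short. -/
theorem IsLatticeForm.exists_isShortest {n : ℕ} {D : ℝ} (hT : IsLatticeForm M T)
    (hM : Submodule.span ℝ (M : Set E) = ⊤)
    (h : CountBound (dualLattice M : Set E) n D) (hT0 : T ≠ 0) : ∃ v, IsShortest M T v := by
  obtain ⟨m, hm, hm0⟩ : ∃ m ∈ M, T m ≠ 0 := by
    by_contra! hc
    apply hT0
    apply LinearMap.ext_on hM
    intro x hx
    simpa using hc x hx
  let S : Set E := {y ∈ (dualLattice M : Set E) | ‖y‖ ≤ ‖T m‖} ∩ {y | y ∈ LinearMap.range T ∧ y ≠ 0}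
  have hS : S.Finite := (h.finite _).inter_of_left _
  have hmS : T m ∈ S := ⟨⟨hT.integral m hm, le_rfl⟩, ⟨_, rfl⟩, hm0⟩
  obtain ⟨v, hv, hmin⟩ := hS.exists_minimalFor (fun y => ‖y‖) S ⟨_, hmS⟩
  refine ⟨v, hv.1.1, hv.2.1, hv.2.2, fun u hu hur hu0 => ?_⟩
  by_contra! hlt
  have huS : u ∈ S := ⟨⟨hu, hlt.le.trans hv.1.2⟩, hur, hu0⟩
  have := hmin huS hlt.le
  simp only at this
  linarith

/-- The lattice points of the quotient by a primitive vector `v` are counted by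
lattice points in a tube in the direction of `v`. -/
theorem CountBound.slice {n : ℕ} {D : ℝ} {b : E} (hb : b ∈ M) (hvb : inner ℝ v b = 1)
    (hv : v ∈ dualLattice M) (hv0 : v ≠ 0)
    (h : CountBound (dualLattice M : Set E) (n + 1) D) :
    CountBound (dualLattice (sliceLattice M v) : Set (perp v)) n (2 ^ (n + 2) * D * ‖v‖) := by
  classical
  intro x ρ hρ P hP
  have hvpos : 0 < ‖v‖ := norm_pos_iff.2 hv0
  have hD := h.one_le
  -- Above each point of `P` stand `N` dual-lattice points spaced by `v`. This tube has length about
  -- `N ‖v‖ ≥ ρ`; it is cut into `K + 1` pieces of length `ρ`, each inside a ball of radius `2ρ`.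
  set N : ℕ := ⌈ρ / ‖v‖⌉₊ with hN
  have hNpos : 0 < N := Nat.ceil_pos.2 (by positivity)
  have hN1 : ρ ≤ N * ‖v‖ := by
    rw [← div_le_iff₀ hvpos]; exact Nat.le_ceil _
  -- The offset in `[0, 1)` for which `y + a y • v` lies in the dual lattice.
  let a : perp v → ℝ := fun y => Int.fract (-(inner ℝ (y : E) b : ℝ))
  let pt : perp v × ℕ → E := fun q => (q.1 : E) + (a q.1 + q.2) • v
  have hpt : ∀ q, inner ℝ v (pt q) = (a q.1 + q.2) * ‖v‖ ^ 2 := by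
    intro q
    rw [inner_add_right, inner_perp, inner_smul_right, real_inner_self_eq_norm_sq]
    ring
  have hinj : Function.Injective pt := by
    rintro ⟨y, i⟩ ⟨z, j⟩ hq
    have h1 := hpt (y, i)
    rw [hq, hpt] at h1
    have h2 : a z + j = a y + i := mul_right_cancel₀ (by positivity) h1
    have h3 : (y : E) = z := by
      have : (y : E) + (a y + i) • v = (z : E) + (a z + j) • v := hq
      rw [h2] at this
      exact add_right_cancel this
    have h4 : y = z := Subtype.ext h3
    subst h4
    have : (j : ℝ) = i := by linarith
    have : j = i := by exact_mod_cast this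
    rw [this]
  have hmem : ∀ q : perp v × ℕ, q.1 ∈ P → pt q ∈ dualLattice M := by
    rintro ⟨y, i⟩ hq
    have h1 := lift_mem_dualLattice hb hvb hv (hP y hq).1
    have h2 := add_intCast_smul_mem h1 hv (-⌊-(inner ℝ (y : E) b : ℝ)⌋ + i)
    convert h2 using 1
    simp only [pt, a, Int.fract]
    push_cast
    module
  set Q := (P ×ˢ Finset.range N).image pt with hQ
  have hQcard : Q.card = P.card * N := by
    rw [hQ, Finset.card_image_of_injective _ hinj, Finset.card_product, Finset.card_range]
  let f : E → ℕ := fun z => ⌊(inner ℝ v z / ‖v‖) / ρ⌋₊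
  have hρ0 : 0 < ρ := by linarith
  set K : ℕ := ⌊N * ‖v‖ / ρ⌋₊ with hK
  have hmaps : ∀ z ∈ Q, f z ∈ Finset.range (K + 1) := by
    intro z hz
    obtain ⟨⟨y, i⟩, hq, rfl⟩ := Finset.mem_image.1 hz
    rw [Finset.mem_product, Finset.mem_range] at hq
    rw [Finset.mem_range, Nat.lt_succ_iff]
    apply Nat.floor_mono
    rw [hpt]
    have h1 : a y < 1 := Int.fract_lt_one _
    have h2 : (i : ℝ) + 1 ≤ N := by exact_mod_cast hq.2
    gcongr
    rw [div_le_iff₀ hvpos]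
    simp only
    nlinarith [sq_nonneg ‖v‖]
  have hfib : ∀ k ∈ Finset.range (K + 1),
      ((Q.filter (fun z => f z = k)).card : ℝ) ≤ D * (2 * ρ) ^ (n + 1) := by
    intro k _
    apply h ((x : E) + (k * ρ / ‖v‖) • v) (2 * ρ) (by linarith)
    intro z hz
    rw [Finset.mem_filter] at hz
    obtain ⟨hz, hk⟩ := hz
    obtain ⟨⟨y, i⟩, hq, rfl⟩ := Finset.mem_image.1 hz
    rw [Finset.mem_product] at hq
    refine ⟨hmem _ hq.1, ?_⟩
    have ha0 : 0 ≤ a y := Int.fract_nonneg _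
    simp only [f] at hk
    rw [hpt, Nat.floor_eq_iff (by positivity)] at hk
    have e1 : (a y + i) * ‖v‖ ^ 2 / ‖v‖ = (a y + i) * ‖v‖ := by field_simp
    simp only [e1] at hk
    rw [le_div_iff₀ hρ0, div_lt_iff₀ hρ0] at hk
    have e2 : pt (y, i) - ((x : E) + (k * ρ / ‖v‖) • v) =
        ((y - x : perp v) : E) + ((a y + i) - k * ρ / ‖v‖) • v := by
      simp only [pt, Submodule.coe_sub]
      module
    rw [e2]
    refine (norm_add_le _ _).trans ?_
    have e3 : ‖((a y + i) - k * ρ / ‖v‖) • v‖ ≤ ρ := by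
      rw [norm_smul, Real.norm_eq_abs, ← abs_of_pos hvpos, ← abs_mul, abs_of_pos hvpos, sub_mul,
        div_mul_cancel₀ _ hvpos.ne', abs_le]
      constructor <;> nlinarith
    have e4 : ‖((y - x : perp v) : E)‖ ≤ ρ := (hP y hq.1).2
    linarith
  have hsum : (Q.card : ℝ) ≤ (K + 1) * (D * (2 * ρ) ^ (n + 1)) := by
    rw [Finset.card_eq_sum_card_fiberwise hmaps]
    push_cast
    refine (Finset.sum_le_sum hfib).trans ?_
    rw [Finset.sum_const, Finset.card_range, nsmul_eq_mul]
    push_cast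
    rfl
  rw [hQcard] at hsum
  push_cast at hsum
  have hK1 : (K : ℝ) ≤ N * ‖v‖ / ρ := Nat.floor_le (by positivity)
  have hK2 : (K : ℝ) + 1 ≤ 2 * (N * ‖v‖ / ρ) := by
    have : 1 ≤ N * ‖v‖ / ρ := by rwa [one_le_div hρ0]
    linarith
  have hNR : (0 : ℝ) < N := by exact_mod_cast hNpos
  have : (P.card : ℝ) * N ≤ (2 ^ (n + 2) * D * ‖v‖ * ρ ^ n) * N := by
    refine hsum.trans ((mul_le_mul_of_nonneg_right hK2 (by positivity)).trans (le_of_eq ?_))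
    field_simp
    ring
  exact le_of_mul_le_mul_right this hNR

end LatticeForms

/-! ### Induction on the rank: counting forms of bounded norm. -/

section LatticeForms

theorem three_quarters_le {a b : ℝ} (ha : 0 ≤ a) (hb : 0 ≤ b) (h : 3 * a ^ 2 ≤ 4 * b ^ 2) :
    a / 2 ≤ b := by
  by_contra! hlt
  nlinarith

/-- A form of small norm and rank at most `2 k` is supported on short vectors. -/
theorem IsShortest.norm_sq_le (k : ℕ) : ∀ (E : Type) [NormedAddCommGroup E]
    [InnerProductSpace ℝ E] [FiniteDimensional ℝ E] (M : AddSubgroup E) (T : E →ₗ[ℝ] E) (v : E)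
    (n : ℕ) (D X : ℝ), Submodule.span ℝ (M : Set E) = ⊤ → finrank ℝ E = n →
    CountBound (dualLattice M : Set E) n D → IsLatticeForm M T → 0 ≤ X →
    finrank ℝ E ≤ finrank ℝ (LinearMap.ker T) + 2 * k → (∀ x, ‖T x‖ ≤ X * ‖x‖) →
    IsShortest M T v → ‖v‖ ^ 2 ≤ 2 ^ k * X := by
  induction k with
  | zero =>
    intro E _ _ _ M T v n D X hM hn hC hT hX0 hk hX hv
    exfalso
    have : LinearMap.ker T = ⊤ := Submodule.eq_top_of_finrank_eq
      (le_antisymm (Submodule.finrank_le _) (by simpa using hk))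
    obtain ⟨u, hu⟩ := hv.mem_range
    have hu' : u ∈ LinearMap.ker T := this ▸ trivial
    exact hv.ne_zero (hu ▸ hu')
  | succ k ih =>
    intro E _ _ _ M T v n D X hM hn hC hT hX0 hk hX hv
    obtain ⟨b, hb, hvb⟩ := hv.exists_inner_eq_one hM
    have hvpos : 0 < ‖v‖ := norm_pos_iff.2 hv.ne_zero
    obtain ⟨n, rfl⟩ : ∃ m, n = m + 1 := by
      have : Nontrivial E := ⟨v, 0, hv.ne_zero⟩
      exact Nat.exists_eq_succ_of_ne_zero (hn ▸ (finrank_pos (R := ℝ) (M := E)).ne')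
    have : Fact (finrank ℝ E = n + 1) := ⟨hn⟩
    have hn' : finrank ℝ (perp v) = n := Submodule.finrank_orthogonal_span_singleton hv.ne_zero
    -- If the compression vanishes, `T v = ‖v‖² y` with `y` the projection of `T b`, so `‖v‖ ‖y‖ ≤
    -- X`, while `‖y‖ ≥ ‖v‖ / 2`. Otherwise induction bounds the shortest vector `w` of the
    -- compression, and `3 ‖v‖² ≤ 4 ‖w‖²`.
    by_cases h0 : compress v T = 0
    · obtain ⟨u, hu⟩ := hv.mem_range
      have hTv : ∀ x : perp v, T x = (inner ℝ v (T x) / ‖v‖ ^ 2) • v := by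
        intro x
        have h1 := coe_compress v T x
        rw [h0] at h1
        exact sub_eq_zero.1 h1.symm
      set y := (perp v).orthogonalProjectionOnto (T b) with hy
      have hyc := coe_proj v (T b)
      rw [← hy] at hyc
      have hyb : (y : E) + (inner ℝ v (T b) / ‖v‖ ^ 2) • v = T b := by rw [hyc]; module
      have hvu : inner ℝ v u = 0 := by rw [← hu, hT.inner_self]
      have hy0 : y ≠ 0 := by
        intro hy0
        have h1 : inner ℝ (T b) u = -1 := by rw [hT.skew, hu, real_inner_comm, hvb]
        rw [← hyb, hy0, inner_add_left, inner_smul_left, hvu] at h1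
        simp at h1
      have hyr : (y : E) ∈ LinearMap.range T := by
        rw [hyc]
        exact Submodule.sub_mem _ ⟨_, rfl⟩ (Submodule.smul_mem _ _ hv.mem_range)
      have h1 := hv.norm_le_of_lift hy0 (by rw [hyb]; exact hT.integral b hb) hyr
      have h2 := three_quarters_le (norm_nonneg v) (norm_nonneg y) h1
      have hTvv : T v = (‖v‖ ^ 2) • (y : E) := by
        have e0 : b - (‖v‖ ^ 2)⁻¹ • v ∈ perp v := by
          rw [Submodule.mem_orthogonal_singleton_iff_inner_right, inner_sub_right,
            inner_smul_right, real_inner_self_eq_norm_sq, hvb,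
            inv_mul_cancel₀ (by positivity), sub_self]
        have e1 := hTv ⟨_, e0⟩
        simp only [map_sub, map_smul] at e1
        have e2 : inner ℝ v (T v) = 0 := by rw [real_inner_comm, hT.inner_self]
        rw [inner_sub_right, inner_smul_right, e2, mul_zero, sub_zero] at e1
        have e3 : T b - (inner ℝ v (T b) / ‖v‖ ^ 2) • v = (‖v‖ ^ 2)⁻¹ • T v := by
          rw [sub_eq_iff_eq_add] at e1 ⊢
          exact e1.trans (add_comm _ _)
        rw [hyc, e3, smul_smul, mul_inv_cancel₀ (by positivity), one_smul]
      have h3 := hX v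
      rw [hTvv, norm_smul, Real.norm_eq_abs, abs_of_nonneg (by positivity)] at h3
      have h4 : ‖v‖ * ‖(y : E)‖ ≤ X := by
        have : (‖v‖ * ‖(y : E)‖) * ‖v‖ ≤ X * ‖v‖ := by nlinarith
        exact le_of_mul_le_mul_right this hvpos
      have h5 : ‖v‖ ^ 2 ≤ 2 * X := by
        rw [Submodule.coe_norm] at h2
        nlinarith
      refine h5.trans ?_
      rw [pow_succ]
      have : (1 : ℝ) ≤ 2 ^ k := one_le_pow₀ (by norm_num)
      nlinarith [mul_nonneg (sub_nonneg.2 this) hX0]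
    · have hC' := hC.slice hb hvb hv.mem hv.ne_zero
      have hM' := span_sliceLattice hM hv.mem hv.ne_zero
      have hT' := hT.isLatticeForm_compress (v := v)
      obtain ⟨w, hw⟩ := hT'.exists_isShortest hM' hC' h0
      have hker := hT.finrank_ker_compress hv.ne_zero hv.mem_range
      have h1 := ih (perp v) _ _ w n _ X hM' hn' hC' hT' hX0 (by omega) (norm_compress_le hX) hw
      have h2 := hv.le_of_mem_compress hM hw.ne_zero hw.mem hw.mem_range
      rw [pow_succ 2 k]
      nlinarith [sq_nonneg ‖w‖]

variable {E : Type} [NormedAddCommGroup E] [InnerProductSpace ℝ E]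
variable {M : AddSubgroup E} {T : E →ₗ[ℝ] E} {v : E}

/-- The forms with a prescribed compression correspond to lattice points of the quotient. -/
theorem card_fiber_compress_le {n : ℕ} {D X c : ℝ} {b : E} (hb : b ∈ M) (hvb : inner ℝ v b = 1)
    (hC : CountBound (dualLattice (sliceLattice M v) : Set (perp v)) n D)
    (hc : 1 ≤ c) (hX : 0 ≤ X) (hvX : ‖v‖ ≤ c * X)
    (S : perp v →ₗ[ℝ] perp v) (A : Finset (E →ₗ[ℝ] E))
    (hA : ∀ T ∈ A, IsLatticeForm M T ∧ (∀ x, ‖T x‖ ≤ X * ‖x‖) ∧ compress v T = S) :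
    (A.card : ℝ) ≤ D * (c * X / ‖v‖) ^ n := by
  classical
  have hv0 : v ≠ 0 := by rintro rfl; simp at hvb
  have hvpos : 0 < ‖v‖ := norm_pos_iff.2 hv0
  have hρ : 1 ≤ c * X / ‖v‖ := by rwa [one_le_div hvpos]
  rcases A.eq_empty_or_nonempty with rfl | ⟨T₀, hT₀⟩
  · have := hC.one_le
    simp only [Finset.card_empty, Nat.cast_zero]
    positivity
  -- As `T v` is orthogonal to `v`, it equals `‖v‖² u T`. Given the compression, `u T` determines
  -- `T`: skewness recovers the `v`-component of `T` on the hyperplane.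
  let u : (E →ₗ[ℝ] E) → perp v :=
    fun T => (‖v‖ ^ 2)⁻¹ • (perp v).orthogonalProjectionOnto (T v)
  have hvv : (‖v‖ ^ 2) ≠ 0 := by positivity
  have hu : ∀ T ∈ A, T v = ‖v‖ ^ 2 • (u T : E) := by
    intro T hT
    have h1 : inner ℝ v (T v) = 0 := by rw [real_inner_comm, (hA T hT).1.inner_self]
    simp only [u, Submodule.coe_smul, coe_proj, h1]
    simp [smul_smul, hvv]
  have hdiff : ∀ T ∈ A, ∀ x : perp v, T x - T₀ x = inner ℝ (T x - T₀ x) b • v := by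
    intro T hT x
    have h1 := congrArg (fun f => ((f x : perp v) : E)) ((hA T hT).2.2.trans (hA T₀ hT₀).2.2.symm)
    simp only [coe_compress] at h1
    have h2 : T x - T₀ x = ((inner ℝ v (T x) / ‖v‖ ^ 2) - (inner ℝ v (T₀ x) / ‖v‖ ^ 2)) • v := by
      rw [sub_smul]
      rw [sub_eq_sub_iff_add_eq_add] at h1 ⊢
      exact h1.trans (add_comm _ _)
    have h3 : inner ℝ (T x - T₀ x) b =
        ((inner ℝ v (T x) / ‖v‖ ^ 2) - (inner ℝ v (T₀ x) / ‖v‖ ^ 2)) := by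
      rw [h2, inner_smul_left, hvb]
      simp
    rw [h3]
    exact h2
  have hsk : ∀ T ∈ A, ∀ x : perp v, inner ℝ (u T) x = -((‖v‖ ^ 2)⁻¹ * inner ℝ v (T x)) := by
    intro T hT x
    have := (hA T hT).1.skew v x
    rw [hu T hT, inner_smul_left] at this
    rw [Submodule.coe_inner, ← mul_neg, ← this]
    simp [hvv]
  -- Only differences need be dual: on the hyperplane `T - T₀` takes values in `ℝ v`, with
  -- coefficient read off by pairing with `b`, hence integral on the slice.
  have hdual : ∀ T ∈ A, u T - u T₀ ∈ dualLattice (sliceLattice M v) := by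
    intro T hT m hm
    obtain ⟨p, hp⟩ := (hA T hT).1.integral m hm b hb
    obtain ⟨q, hq⟩ := (hA T₀ hT₀).1.integral m hm b hb
    refine ⟨q - p, ?_⟩
    have h1 := congrArg (fun z => inner ℝ v z) (hdiff T hT m)
    simp only [inner_sub_right, inner_sub_left, inner_smul_right, hp, hq,
      real_inner_self_eq_norm_sq] at h1
    rw [inner_sub_left, hsk T hT, hsk T₀ hT₀]
    push_cast
    field_simp
    linarith
  have hinj : Set.InjOn u (A : Set (E →ₗ[ℝ] E)) := by
    intro T hT T' hT' hTT
    have hvT : T v = T' v := by rw [hu T hT, hu T' hT', hTT]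
    have hx : ∀ x : perp v, T x = T' x := by
      intro x
      have h1 : T x - T' x = (inner ℝ (T x - T₀ x) b - inner ℝ (T' x - T₀ x) b) • v := by
        rw [sub_smul, ← hdiff T hT, ← hdiff T' hT']
        abel
      have h2 : inner ℝ (T x - T' x) v = 0 := by
        rw [inner_sub_left, (hA T hT).1.skew, (hA T' hT').1.skew, hvT, sub_self]
      rw [h1, inner_smul_left, real_inner_self_eq_norm_sq, mul_eq_zero] at h2
      rcases h2 with h2 | h2
      · rw [← sub_eq_zero, h1]
        have : inner ℝ (T x - T₀ x) b - inner ℝ (T' x - T₀ x) b = 0 := by simpa using h2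
        rw [this, zero_smul]
      · exact absurd h2 hvv
    ext x
    have h1 := coe_proj v x
    have h2 : x = ((perp v).orthogonalProjectionOnto x : E) + (inner ℝ v x / ‖v‖ ^ 2) • v := by
      rw [h1]; module
    rw [h2, map_add, map_add, map_smul, map_smul, hx, hvT]
  have hinj' : Set.InjOn (fun T => u T - u T₀) (A : Set (E →ₗ[ℝ] E)) :=
    fun T hT T' hT' h => hinj hT hT' (sub_left_injective h)
  have := hC (-u T₀) (c * X / ‖v‖) hρ (A.image (fun T => u T - u T₀)) (by
    intro y hy
    obtain ⟨T, hT, rfl⟩ := Finset.mem_image.1 hy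
    refine ⟨hdual T hT, ?_⟩
    rw [sub_neg_eq_add, sub_add_cancel, le_div_iff₀ hvpos]
    have h1 := (hA T hT).2.1 v
    rw [hu T hT, norm_smul, Real.norm_eq_abs, abs_of_nonneg (by positivity)] at h1
    have h2 : (‖u T‖ * ‖v‖) * ‖v‖ ≤ X * ‖v‖ := by
      rw [Submodule.coe_norm]; nlinarith
    have h3 := le_of_mul_le_mul_right h2 hvpos
    nlinarith)
  rwa [Finset.card_image_of_injOn hinj'] at this

/-- The number of integral alternating forms of rank at most `2 k` and norm at most `X` whose
support contains no short vectors. -/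
theorem exists_card_forms_le (k : ℕ) : ∀ (n : ℕ) (δ : ℝ), 0 < δ → δ ≤ 1 → ∃ C : ℝ, 0 < C ∧
    ∀ (E : Type) [NormedAddCommGroup E] [InnerProductSpace ℝ E] [FiniteDimensional ℝ E]
      (M : AddSubgroup E) (D X : ℝ), Submodule.span ℝ (M : Set E) = ⊤ → finrank ℝ E = n →
      CountBound (dualLattice M : Set E) n D → 1 ≤ X → ∀ A : Finset (E →ₗ[ℝ] E),
      (∀ T ∈ A, IsLatticeForm M T ∧ finrank ℝ E ≤ finrank ℝ (LinearMap.ker T) + 2 * k ∧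
        (∀ x, ‖T x‖ ≤ X * ‖x‖) ∧
        ∀ u ∈ dualLattice M, u ∈ LinearMap.range T → u ≠ 0 → δ ≤ ‖u‖) →
      (A.card : ℝ) ≤ C * D ^ (2 * k) * X ^ (n * k) := by
  classical
  induction k with
  | zero =>
    intro n δ hδ hδ1
    refine ⟨1, one_pos, ?_⟩
    intro E _ _ _ M D X hM hn hC hX A hA
    have h0 : ∀ T ∈ A, T = 0 := by
      intro T hT
      rw [← LinearMap.ker_eq_top]
      exact Submodule.eq_top_of_finrank_eq
        (le_antisymm (Submodule.finrank_le _) (by simpa using (hA T hT).2.1))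
    have : A.card ≤ 1 := Finset.card_le_one.2 fun a ha b hb => by rw [h0 a ha, h0 b hb]
    simpa using this
  | succ k ih =>
    intro n δ hδ hδ1
    rcases n with _ | n
    · refine ⟨1, one_pos, ?_⟩
      intro E _ _ _ M D X hM hn hC hX A hA
      have : Subsingleton E := finrank_zero_iff.1 hn
      have h1 : A.card ≤ 1 := Finset.card_le_one.2 fun a _ b _ => by
        ext x; exact Subsingleton.elim _ _
      have h2 : (A.card : ℝ) ≤ 1 := by exact_mod_cast h1
      have h3 : 1 ≤ D ^ (2 * (k + 1)) := one_le_pow₀ hC.one_le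
      simpa using h2.trans h3
    -- Compression can shorten the supporting vectors by a constant factor, so the threshold is
    -- halved.
    obtain ⟨C₁, hC₁, hind⟩ := ih n (δ / 2) (by positivity) (by linarith)
    set c : ℝ := 2 ^ (k + 1) with hc
    have hc1 : 1 ≤ c := one_le_pow₀ (by norm_num)
    set K : ℝ := C₁ * (2 ^ (n + 2)) ^ (2 * k + 1) * c ^ n with hK
    have hKpos : 0 < K := by positivity
    refine ⟨1 + K * (2 ^ (n + 2) / δ ^ (n + 1)) * c ^ (k + 1), by positivity, ?_⟩
    intro E _ _ _ M D X hM hn hC hX A hA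
    have hD := hC.one_le
    have hX0 : 0 ≤ X := by linarith
    have : Fact (finrank ℝ E = n + 1) := ⟨hn⟩
    have hex : ∀ T ∈ A.filter (· ≠ 0), ∃ v, IsShortest M T v := fun T hT => by
      rw [Finset.mem_filter] at hT
      exact (hA T hT.1).1.exists_isShortest hM hC hT.2
    choose! vf hvf using hex
    set A' := A.filter (· ≠ 0) with hA'
    have hA'mem : ∀ T ∈ A', T ∈ A := fun T hT => (Finset.mem_filter.1 hT).1
    have hvsq : ∀ T ∈ A', ‖vf T‖ ^ 2 ≤ c * X := fun T hT => by
      have h := hA T (hA'mem T hT)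
      exact IsShortest.norm_sq_le (k + 1) E M T (vf T) (n + 1) D X hM hn hC h.1 hX0 h.2.1 h.2.2.1
        (hvf T hT)
    have hvδ : ∀ T ∈ A', δ ≤ ‖vf T‖ := fun T hT =>
      (hA T (hA'mem T hT)).2.2.2 _ (hvf T hT).mem (hvf T hT).mem_range (hvf T hT).ne_zero
    -- Compressions number `O((D‖v‖)^(2k) X^(nk))`, and each has `O(D‖v‖ (X/‖v‖)^n)` preimages. The
    -- weight `‖v‖^(2k+1-n)` is written with both exponents raised by one to match
    -- `CountBound.sum_le` in dimension `n + 1`.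
    have hfib : ∀ v ∈ A'.image vf, ((A'.filter (fun T => vf T = v)).card : ℝ) ≤
        K * D ^ (2 * k + 1) * X ^ (n * (k + 1)) * (‖v‖ ^ (2 * k + 2) / ‖v‖ ^ (n + 1)) := by
      intro v hv
      obtain ⟨T₁, hT₁, hT₁v⟩ := Finset.mem_image.1 hv
      have hsv : IsShortest M T₁ v := hT₁v ▸ hvf T₁ hT₁
      have hv2 : ‖v‖ ^ 2 ≤ c * X := hT₁v ▸ hvsq T₁ hT₁
      have hvd : δ ≤ ‖v‖ := hT₁v ▸ hvδ T₁ hT₁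
      have hvpos : 0 < ‖v‖ := by linarith
      obtain ⟨b, hb, hvb⟩ := hsv.exists_inner_eq_one hM
      have hC' := hC.slice hb hvb hsv.mem hsv.ne_zero
      have hM' := span_sliceLattice hM hsv.mem hsv.ne_zero
      have hn' : finrank ℝ (perp v) = n :=
        Submodule.finrank_orthogonal_span_singleton hsv.ne_zero
      have hcX : 1 ≤ c * X := one_le_mul_of_one_le_of_one_le hc1 hX
      have hvX : ‖v‖ ≤ c * X := by nlinarith
      set B := A'.filter (fun T => vf T = v) with hB
      have hBmem : ∀ T ∈ B, T ∈ A ∧ IsShortest M T v := fun T hT => by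
        rw [hB, Finset.mem_filter] at hT
        exact ⟨hA'mem T hT.1, hT.2 ▸ hvf T hT.1⟩
      have h1 := hind (perp v) (sliceLattice M v) _ X hM' hn' hC' hX (B.image (compress v)) (by
        intro S hS
        obtain ⟨T, hT, rfl⟩ := Finset.mem_image.1 hS
        obtain ⟨hTA, hTv⟩ := hBmem T hT
        have h := hA T hTA
        refine ⟨h.1.isLatticeForm_compress, ?_, norm_compress_le h.2.2.1, ?_⟩
        · have := h.1.finrank_ker_compress hTv.ne_zero hTv.mem_range
          have := h.2.1
          omega
        · intro u hu hur hu0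
          have := three_quarters_le (norm_nonneg v) (norm_nonneg u)
            (hTv.le_of_mem_compress hM hu0 hu hur)
          linarith)
      have h2 : (B.card : ℝ) ≤ (B.image (compress v)).card *
          ((2 ^ (n + 2) * D * ‖v‖) * (c * X / ‖v‖) ^ n) := by
        rw [Finset.card_eq_sum_card_image (compress v) B]
        push_cast
        rw [← nsmul_eq_mul]
        apply Finset.sum_le_card_nsmul
        intro S _
        apply card_fiber_compress_le hb hvb hC' hc1 hX0 hvX S
        intro T hT
        rw [Finset.mem_filter] at hT
        have h := hA T (hBmem T hT.1).1
        exact ⟨h.1, h.2.2.1, hT.2⟩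
      calc (B.card : ℝ) ≤ (C₁ * (2 ^ (n + 2) * D * ‖v‖) ^ (2 * k) * X ^ (n * k)) *
          ((2 ^ (n + 2) * D * ‖v‖) * (c * X / ‖v‖) ^ n) := by
            refine h2.trans (mul_le_mul_of_nonneg_right h1 (by positivity))
        _ = K * D ^ (2 * k + 1) * X ^ (n * (k + 1)) * (‖v‖ ^ (2 * k + 2) / ‖v‖ ^ (n + 1)) := by
            rw [hK, div_pow, mul_pow c X n]
            have e : ‖v‖ ^ (2 * k + 2) / ‖v‖ ^ (n + 1) = ‖v‖ ^ (2 * k + 1) / ‖v‖ ^ n := by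
              rw [pow_succ _ (2 * k + 1), pow_succ _ n, mul_div_mul_right _ _ hvpos.ne']
            rw [e]
            ring
    have hR0 : 0 ≤ Real.sqrt (c * X) := Real.sqrt_nonneg _
    obtain ⟨J, hJ⟩ := pow_unbounded_of_one_lt (Real.sqrt (c * X) / δ) (one_lt_two : (1 : ℝ) < 2)
    rw [div_lt_iff₀ hδ] at hJ
    have hsum := hC.sum_le (q := 2 * k + 2) (by linarith) (by omega) hδ hδ1 J _ hR0 hJ
      (A'.image vf) (by
        intro v hv
        obtain ⟨T, hT, rfl⟩ := Finset.mem_image.1 hv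
        exact ⟨(hvf T hT).mem, hvδ T hT, Real.le_sqrt_of_sq_le (hvsq T hT)⟩)
    -- The sum over `v` supplies the missing factor `X^(k+1)`, raising `X^(n(k+1))` to
    -- `X^((n+1)(k+1))`.
    have hRpow : Real.sqrt (c * X) ^ (2 * k + 2) = c ^ (k + 1) * X ^ (k + 1) := by
      rw [show 2 * k + 2 = 2 * (k + 1) by ring, pow_mul, Real.sq_sqrt (by positivity), mul_pow]
    rw [hRpow] at hsum
    have hA'card : (A'.card : ℝ) ≤ K * D ^ (2 * k + 1) * X ^ (n * (k + 1)) *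
        (2 ^ (n + 2) / δ ^ (n + 1) * D * (c ^ (k + 1) * X ^ (k + 1))) := by
      rw [Finset.card_eq_sum_card_image vf A']
      push_cast
      refine (Finset.sum_le_sum hfib).trans ?_
      rw [← Finset.mul_sum]
      exact mul_le_mul_of_nonneg_left hsum (by positivity)
    have hAcard : (A.card : ℝ) ≤ A'.card + 1 := by
      have h1 := Finset.card_filter_add_card_filter_not (s := A) (fun T => T ≠ 0)
      have h2 : (A.filter (fun T => ¬ T ≠ 0)).card ≤ 1 := Finset.card_le_one.2 fun a ha b hb => by
        simp only [Finset.mem_filter, not_not] at ha hb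
        rw [ha.2, hb.2]
      have : A.card ≤ A'.card + 1 := by
        rw [← h1]
        exact Nat.add_le_add (le_of_eq (by rw [hA'])) (by convert h2)
      exact_mod_cast this
    have hone : 1 ≤ D ^ (2 * (k + 1)) * X ^ ((n + 1) * (k + 1)) :=
      one_le_mul_of_one_le_of_one_le (one_le_pow₀ hD) (one_le_pow₀ hX)
    calc (A.card : ℝ) ≤ A'.card + 1 := hAcard
      _ ≤ K * D ^ (2 * k + 1) * X ^ (n * (k + 1)) *
        (2 ^ (n + 2) / δ ^ (n + 1) * D * (c ^ (k + 1) * X ^ (k + 1))) +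
          D ^ (2 * (k + 1)) * X ^ ((n + 1) * (k + 1)) := add_le_add hA'card hone
      _ = _ := by ring

end LatticeForms

/-! ### Diagonally dominant integer matrices and row counts modulo a prime. -/

section Sieve

open Matrix

/-- The `i`-th row of a perturbation of a multiple of the identity, congruent to the `i`-th
standard vector modulo `Q`. -/
def sieveRow {n H : ℕ} (Q i : ℕ) (y : Fin n → Fin H) (j : Fin n) : ℤ :=
  (if (j : ℕ) = i then (1 + 2 * (n : ℤ) * Q * H) else 0) + Q * (y j : ℕ)

/-- The matrix with rows `sieveRow`. -/
def sieveMatrix {n H i : ℕ} (Q : ℕ) (P : Fin i → Fin n → Fin H) : Matrix (Fin i) (Fin n) ℤ :=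
  fun s => sieveRow Q s (P s)

/-- The reduction modulo `p` of an integer vector. -/
def reduceMod {n : ℕ} (p : ℕ) (x : Fin n → ℤ) : Fin n → ZMod p := fun j => (x j : ZMod p)

/-- The rows are linearly independent modulo every prime. -/
def RowsUnimodular {i n : ℕ} (B : Matrix (Fin i) (Fin n) ℤ) : Prop :=
  ∀ p : ℕ, p.Prime → LinearIndependent (ZMod p) (fun s => reduceMod p (B s))

/-- The leading square block. -/
def leadBlock {i n : ℕ} (h : i ≤ n) (B : Matrix (Fin i) (Fin n) ℤ) : Matrix (Fin i) (Fin i) ℤ :=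
  B.submatrix id (Fin.castLE h)

variable {n H i Q : ℕ}

/-- Diagonal dominance: where `|a|` is largest, the diagonal contributes `|a| (1 + 2nQH)` and the
perturbation at most `|a| nQH`. -/
theorem abs_mul_le_of_vecMul_leadBlock (h : i ≤ n) (P : Fin i → Fin n → Fin H) (a : Fin i → ℤ)
    (N : ℤ) (hN : ∀ s, |(a ᵥ* leadBlock h (sieveMatrix Q P)) s| ≤ N) (s : Fin i) :
    |a s| * (1 + n * Q * H) ≤ N := by
  have : Nonempty (Fin i) := ⟨s⟩
  obtain ⟨s₀, hs₀⟩ := Finite.exists_max (fun s => |a s|)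
  have h1 : (a ᵥ* leadBlock h (sieveMatrix Q P)) s₀ =
      a s₀ * (1 + 2 * n * Q * H) + ∑ t, a t * (Q * (P t (Fin.castLE h s₀) : ℕ)) := by
    simp only [vecMul, dotProduct, leadBlock, sieveMatrix, sieveRow, submatrix_apply, id, mul_add,
      Finset.sum_add_distrib, Fin.val_castLE, mul_ite, mul_zero, ← Fin.ext_iff]
    congr 1
    rw [Finset.sum_ite_eq]
    simp
  have h2 : |∑ t, a t * (Q * (P t (Fin.castLE h s₀) : ℕ) : ℤ)| ≤ n * (|a s₀| * (Q * H)) := by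
    refine (Finset.abs_sum_le_sum_abs _ _).trans ?_
    refine (Finset.sum_le_card_nsmul _ _ (|a s₀| * (Q * H)) ?_).trans ?_
    · intro t _
      rw [abs_mul]
      have h3 : |((Q : ℤ) * (P t (Fin.castLE h s₀) : ℕ))| ≤ Q * H := by
        rw [abs_of_nonneg (by positivity)]
        have : ((P t (Fin.castLE h s₀) : ℕ) : ℤ) ≤ H := by
          exact_mod_cast (P t (Fin.castLE h s₀)).2.le
        gcongr
      exact mul_le_mul (hs₀ t) h3 (abs_nonneg _) (abs_nonneg _)
    · rw [Finset.card_univ, Fintype.card_fin, nsmul_eq_mul]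
      gcongr
  have h3 := hN s₀
  rw [h1] at h3
  have h4 : |a s₀ * (1 + 2 * n * Q * H)| = |a s₀| * (1 + 2 * n * Q * H) := by
    rw [abs_mul, abs_of_nonneg (a := (1 + 2 * n * Q * H : ℤ)) (by positivity)]
  have h5 := abs_sub_abs_le_abs_sub (a s₀ * (1 + 2 * n * Q * H : ℤ))
    (-∑ t, a t * (Q * (P t (Fin.castLE h s₀) : ℕ) : ℤ))
  rw [abs_neg, sub_neg_eq_add, h4] at h5
  have h6 : |a s| * (1 + n * Q * H : ℤ) ≤ |a s₀| * (1 + n * Q * H : ℤ) :=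
    mul_le_mul_of_nonneg_right (hs₀ s) (by positivity)
  linarith

theorem det_leadBlock_ne_zero (h : i ≤ n) (P : Fin i → Fin n → Fin H) :
    (leadBlock h (sieveMatrix Q P)).det ≠ 0 := by
  intro h0
  obtain ⟨a, ha, ha0⟩ := exists_vecMul_eq_zero_iff.2 h0
  apply ha
  ext s
  have h1 := abs_mul_le_of_vecMul_leadBlock h P a 0 (by intro s; rw [ha0]; simp) s
  have h2 : (0 : ℤ) < 1 + n * Q * H := by positivity
  have h3 : |a s| ≤ 0 := by
    by_contra! h4
    nlinarith
  exact abs_nonpos_iff.1 h3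

theorem abs_sieveMatrix_le (hn : 1 ≤ n) (hQ : 1 ≤ Q) (hH : 1 ≤ H) (P : Fin i → Fin n → Fin H)
    (s : Fin i) (j : Fin n) :
    |sieveMatrix Q P s j| ≤ 1 + 2 * n * Q * H + Q * H := by
  have h1 : ((P s j : ℕ) : ℤ) ≤ H := by exact_mod_cast (P s j).2.le
  have h2 : (Q : ℤ) * (P s j : ℕ) ≤ Q * H := by gcongr
  have h3 : (0 : ℤ) ≤ Q * (P s j : ℕ) := by positivity
  have h4 : (0 : ℤ) ≤ 2 * n * Q * H := by positivity
  unfold sieveMatrix sieveRow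
  rw [abs_le]
  split_ifs <;> constructor <;> linarith

theorem abs_sieveMatrix_le' (hn : 1 ≤ n) (hQ : 1 ≤ Q) (hH : 1 ≤ H) (P : Fin i → Fin n → Fin H)
    (s : Fin i) (j : Fin n) :
    |sieveMatrix Q P s j| ≤ 4 * n * Q * H := by
  refine (abs_sieveMatrix_le hn hQ hH P s j).trans ?_
  have h1 : (1 : ℤ) ≤ Q * H := by exact_mod_cast Nat.mul_pos hQ hH
  have h2 : (1 : ℤ) * (Q * H) ≤ n * (Q * H) := by
    have : (1 : ℤ) ≤ n := by exact_mod_cast hn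
    gcongr
  nlinarith

/-- Once `H` exceeds the constant, the minor is below `H ^ (i + 1)`, so it has at most `i` prime
factors above `H`. -/
theorem abs_det_leadBlock_le (hn : 1 ≤ n) (hQ : 1 ≤ Q) (hH : 1 ≤ H) (h : i ≤ n)
    (P : Fin i → Fin n → Fin H) :
    |(leadBlock h (sieveMatrix Q P)).det| ≤ (n.factorial * (4 * n * Q) ^ n : ℕ) * (H : ℤ) ^ i := by
  have h1 := Matrix.det_le (A := leadBlock h (sieveMatrix Q P)) (abv := AbsoluteValue.abs)
    (x := 4 * n * Q * H) (fun s t => abs_sieveMatrix_le' hn hQ hH P _ _)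
  simp only [AbsoluteValue.abs_apply, Fintype.card_fin, nsmul_eq_mul] at h1
  refine h1.trans ?_
  rw [mul_pow _ (H : ℤ), ← mul_assoc]
  push_cast
  have h2 : (i.factorial : ℤ) ≤ n.factorial := by exact_mod_cast Nat.factorial_le h
  have h3 : (4 * n * Q : ℤ) ^ i ≤ (4 * n * Q) ^ n := by
    apply pow_le_pow_right₀ _ h
    have : 1 ≤ 4 * n * Q := by nlinarith [Nat.mul_pos hn hQ]
    exact_mod_cast this
  gcongr

theorem card_large_primeFactors_le {d : ℤ} (hd : d ≠ 0) {H i : ℕ} (hH : 1 ≤ H)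
    (hdH : |d| < (H : ℤ) ^ (i + 1)) :
    (d.natAbs.primeFactors.filter (fun p => H < p)).card ≤ i := by
  set S := d.natAbs.primeFactors.filter (fun p => H < p) with hS
  have hd' : d.natAbs ≠ 0 := Int.natAbs_ne_zero.2 hd
  have h1 : H ^ S.card ≤ ∏ p ∈ S, p := by
    rw [← Finset.prod_const]
    exact Finset.prod_le_prod' fun p hp => (Finset.mem_filter.1 hp).2.le
  have h2 : ∏ p ∈ S, p ≤ d.natAbs := by
    apply Nat.le_of_dvd (Nat.pos_of_ne_zero hd')
    exact (Finset.prod_dvd_prod_of_subset _ _ _ (Finset.filter_subset _ _)).trans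
      (Nat.prod_primeFactors_dvd _)
  have h3 : d.natAbs < H ^ (i + 1) := by
    zify
    exact hdH
  by_contra! hlt
  have : H ^ (i + 1) ≤ H ^ S.card := Nat.pow_le_pow_right hH hlt
  omega

/-- Take `I` minimal among the coordinate sets that detect `W`. Minimality yields, for each `j ∈ I`,
a vector of `W` vanishing on the rest of `I` but not at `j`; these are independent. -/
theorem exists_coordinates {K : Type*} [Field K] {n : ℕ} (W : Submodule K (Fin n → K)) :
    ∃ I : Finset (Fin n), I.card ≤ finrank K W ∧ ∀ w ∈ W, (∀ j ∈ I, w j = 0) → w = 0 := by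
  classical
  let F : Finset (Finset (Fin n)) :=
    Finset.univ.filter (fun I => ∀ w ∈ W, (∀ j ∈ I, w j = 0) → w = 0)
  have hF : F.Nonempty := ⟨Finset.univ, by
    simp only [F, Finset.mem_filter, Finset.mem_univ, true_and]
    intro w _ h
    ext j
    exact h j trivial⟩
  obtain ⟨I, hI, hmin⟩ := Finset.exists_min_image F Finset.card hF
  have hI' := (Finset.mem_filter.1 hI).2
  refine ⟨I, ?_, hI'⟩
  have hex : ∀ j : I, ∃ w : W, (∀ t : I, t ≠ j → w.1 t = 0) ∧ w.1 j ≠ 0 := by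
    rintro ⟨j, hj⟩
    by_contra! hc
    have hmem : I.erase j ∈ F := by
      simp only [F, Finset.mem_filter, Finset.mem_univ, true_and]
      intro w hw hz
      have h1 := hc ⟨w, hw⟩ (fun t ht =>
        hz _ (Finset.mem_erase.2 ⟨fun h => ht (Subtype.ext h), t.2⟩))
      apply hI' w hw
      intro t ht
      by_cases htj : t = j
      · exact htj ▸ h1
      · exact hz t (Finset.mem_erase.2 ⟨htj, ht⟩)
    have := hmin _ hmem
    have := Finset.card_erase_lt_of_mem hj
    omega
  choose w hw0 hw1 using hex
  have hli : LinearIndependent K w := by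
    rw [Fintype.linearIndependent_iff]
    intro g hg j
    have h1 := congrArg (fun u : W => u.1 j) hg
    simp only [Submodule.coe_sum, Submodule.coe_smul, Finset.sum_apply, Pi.smul_apply, smul_eq_mul,
      Submodule.coe_zero, Pi.zero_apply] at h1
    rw [Finset.sum_eq_single j (fun t _ ht => by rw [hw0 t j (Ne.symm ht), mul_zero])
      (fun h => absurd (Finset.mem_univ _) h)] at h1
    exact (mul_eq_zero.1 h1).resolve_right (hw1 j)
  simpa using hli.fintype_card_le_finrank

theorem sieveRow_reduceMod_eq_iff {p : ℕ} [Fact p.Prime] (hpQ : ¬ p ∣ Q) {y z : Fin n → Fin H}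
    {j : Fin n} : reduceMod p (sieveRow Q i y) j = reduceMod p (sieveRow Q i z) j ↔
      ((y j : ℕ) : ZMod p) = (z j : ℕ) := by
  have hQ0 : (Q : ZMod p) ≠ 0 := by rwa [Ne, ZMod.natCast_eq_zero_iff]
  unfold reduceMod sieveRow
  push_cast
  rw [add_right_inj]
  exact mul_right_inj' hQ0

theorem eq_of_sieveRow_reduceMod_eq {p : ℕ} [Fact p.Prime] (hpQ : ¬ p ∣ Q) (hp : H < p)
    {y z : Fin n → Fin H}
    (h : reduceMod p (sieveRow Q i y) = reduceMod p (sieveRow Q i z)) : y = z := by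
  ext j
  have h1 := (sieveRow_reduceMod_eq_iff hpQ).1 (congrFun h j)
  rw [ZMod.natCast_eq_natCast_iff'] at h1
  rwa [Nat.mod_eq_of_lt ((y j).2.trans hp), Nat.mod_eq_of_lt ((z j).2.trans hp)] at h1

open Classical in
-- Each vector modulo `p` has at most `(H/p + 1)^n ≤ (2H/p)^n` preimages.
theorem card_sieveRow_mem_mul_le {p : ℕ} [Fact p.Prime] (hpQ : ¬ p ∣ Q) (hp : p ≤ H)
    (W : Submodule (ZMod p) (Fin n → ZMod p)) :
    (Finset.univ.filter (fun y : Fin n → Fin H => reduceMod p (sieveRow Q i y) ∈ W)).card * p ^ n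
      ≤ p ^ finrank (ZMod p) W * (2 * H) ^ n := by
  set S := Finset.univ.filter (fun y : Fin n → Fin H => reduceMod p (sieveRow Q i y) ∈ W) with hS
  have hp0 : 0 < p := (Fact.out : p.Prime).pos
  have h1 := Finset.card_le_mul_card_image (f := fun y => reduceMod p (sieveRow Q i y)) S
    ((H / p + 1) ^ n) (by
      intro w hw
      obtain ⟨y₀, hy₀, rfl⟩ := Finset.mem_image.1 hw
      have hsub : S.filter (fun y => reduceMod p (sieveRow Q i y) = reduceMod p (sieveRow Q i y₀)) ⊆
          Fintype.piFinset (fun j => Finset.univ.filter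
            (fun t : Fin H => ((t : ℕ) : ZMod p) = (y₀ j : ℕ))) := by
        intro y hy
        rw [Fintype.mem_piFinset]
        intro j
        rw [Finset.mem_filter] at hy ⊢
        exact ⟨Finset.mem_univ _, (sieveRow_reduceMod_eq_iff hpQ).1 (congrFun hy.2 j)⟩
      refine (Finset.card_le_card hsub).trans ?_
      rw [Fintype.card_piFinset]
      refine (Finset.prod_le_pow_card _ _ (H / p + 1) ?_).trans (by simp)
      intro j _
      rw [← Finset.card_range (H / p + 1)]
      apply Finset.card_le_card_of_injOn (fun t : Fin H => (t : ℕ) / p)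
      · intro t _
        simp only [Finset.coe_range, Set.mem_Iio]
        exact Nat.lt_succ_of_le (Nat.div_le_div_right t.2.le)
      · intro t ht u hu htu
        simp only [Finset.coe_filter, Finset.mem_univ, true_and, Set.mem_ofPred_eq] at ht hu htu
        have h2 := ht.trans hu.symm
        rw [ZMod.natCast_eq_natCast_iff'] at h2
        apply Fin.ext
        rw [← Nat.div_add_mod (t : ℕ) p, ← Nat.div_add_mod (u : ℕ) p, htu, h2])
  have h2 : (S.image (fun y => reduceMod p (sieveRow Q i y))).card ≤ p ^ finrank (ZMod p) W := by
    have h3 : S.image (fun y => reduceMod p (sieveRow Q i y)) ⊆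
        (Finset.univ : Finset (Fin n → ZMod p)).filter (· ∈ W) := by
      intro w hw
      obtain ⟨y, hy, rfl⟩ := Finset.mem_image.1 hw
      exact Finset.mem_filter.2 ⟨Finset.mem_univ _, (Finset.mem_filter.1 hy).2⟩
    refine (Finset.card_le_card h3).trans (le_of_eq ?_)
    rw [← Fintype.card_subtype]
    have := Module.card_eq_pow_finrank (K := ZMod p) (V := W)
    rw [ZMod.card] at this
    exact this
  calc S.card * p ^ n ≤ ((H / p + 1) ^ n * p ^ finrank (ZMod p) W) * p ^ n :=
        Nat.mul_le_mul_right _ (h1.trans (Nat.mul_le_mul_left _ h2))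
    _ = p ^ finrank (ZMod p) W * ((H / p + 1) * p) ^ n := by rw [mul_pow]; ring
    _ ≤ p ^ finrank (ZMod p) W * (2 * H) ^ n := by
        refine Nat.mul_le_mul_left _ (Nat.pow_le_pow_left ?_ _)
        have := Nat.div_mul_le_self H p
        linarith

open Classical in
-- For `p > H` reduction is injective on the box, and a vector of `W` is determined by `dim W`
-- coordinates.
theorem card_sieveRow_mem_le {p : ℕ} [Fact p.Prime] (hpQ : ¬ p ∣ Q) (hp : H < p) (hH : 1 ≤ H)
    (W : Submodule (ZMod p) (Fin n → ZMod p)) :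
    (Finset.univ.filter (fun y : Fin n → Fin H => reduceMod p (sieveRow Q i y) ∈ W)).card
      ≤ H ^ finrank (ZMod p) W := by
  obtain ⟨I, hI, hIW⟩ := exists_coordinates W
  refine le_trans ?_ (Nat.pow_le_pow_right hH hI)
  have h1 : H ^ I.card = (Finset.univ : Finset (I → Fin H)).card := by simp
  rw [h1]
  apply Finset.card_le_card_of_injOn (fun y (j : I) => y j)
    (fun _ _ => Finset.mem_coe.2 (Finset.mem_univ _))
  intro y hy z hz hyz
  simp only [Finset.coe_filter, Finset.mem_univ, true_and, Set.mem_ofPred_eq] at hy hz hyz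
  apply eq_of_sieveRow_reduceMod_eq hpQ hp
  rw [← sub_eq_zero]
  apply hIW _ (W.sub_mem hy hz)
  intro j hj
  rw [Pi.sub_apply, sub_eq_zero, sieveRow_reduceMod_eq_iff hpQ]
  rw [show y j = z j from congrFun hyz ⟨j, hj⟩]

end Sieve

/-! ### Sieving row by row for independence modulo every prime. -/

section Sieve

open Matrix

variable {n H i Q : ℕ}

theorem linearIndependent_leadBlock {p : ℕ} [Fact p.Prime] (h : i ≤ n)
    (B : Matrix (Fin i) (Fin n) ℤ) (hp : ¬ (p : ℤ) ∣ (leadBlock h B).det) :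
    LinearIndependent (ZMod p) (fun s => reduceMod p (leadBlock h B s)) := by
  have h1 : ((leadBlock h B).map (Int.castRingHom (ZMod p))).det ≠ 0 := by
    rw [← RingHom.mapMatrix_apply, ← RingHom.map_det, eq_intCast, Ne, ZMod.intCast_zmod_eq_zero_iff_dvd]
    exact hp
  exact linearIndependent_rows_iff_isUnit.2 ((isUnit_iff_isUnit_det _).2 h1.isUnit)

theorem linearIndependent_of_leadBlock {p : ℕ} [Fact p.Prime] (h : i ≤ n)
    (B : Matrix (Fin i) (Fin n) ℤ) (hp : ¬ (p : ℤ) ∣ (leadBlock h B).det) :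
    LinearIndependent (ZMod p) (fun s => reduceMod p (B s)) :=
  LinearIndependent.of_comp (LinearMap.funLeft (ZMod p) (ZMod p) (Fin.castLE h))
    (linearIndependent_leadBlock h B hp)

/-- The leading block is the identity modulo `Q`, so primes dividing `Q` need no sieving. -/
theorem not_dvd_det_leadBlock_of_dvd {p : ℕ} [Fact p.Prime] (h : i ≤ n) (hpQ : p ∣ Q)
    (P : Fin i → Fin n → Fin H) : ¬ (p : ℤ) ∣ (leadBlock h (sieveMatrix Q P)).det := by
  have hQ : (Q : ZMod p) = 0 := (ZMod.natCast_eq_zero_iff _ _).2 hpQ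
  rw [← ZMod.intCast_zmod_eq_zero_iff_dvd, ← eq_intCast (Int.castRingHom (ZMod p)),
    RingHom.map_det]
  have : (Int.castRingHom (ZMod p)).mapMatrix (leadBlock h (sieveMatrix Q P)) = 1 := by
    ext s t
    simp only [RingHom.mapMatrix_apply, map_apply, leadBlock, sieveMatrix, sieveRow,
      submatrix_apply, id, Fin.val_castLE, eq_intCast, one_apply, ← Fin.ext_iff]
    push_cast
    rw [hQ]
    by_cases hst : s = t
    · simp [hst]
    · simp [hst, Ne.symm hst]
  rw [this, det_one]
  exact one_ne_zero

theorem reduceMod_sieveMatrix_snoc (p : ℕ) (P : Fin i → Fin n → Fin H) (y : Fin n → Fin H) :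
    (fun s => reduceMod p (sieveMatrix Q (Fin.snoc (α := fun _ => Fin n → Fin H) P y) s)) =
      Fin.snoc (α := fun _ => Fin n → ZMod p) (fun s => reduceMod p (sieveMatrix Q P s))
        (reduceMod p (sieveRow Q i y)) := by
  funext s
  refine Fin.lastCases ?_ (fun s => ?_) s
  · simp [sieveMatrix]
  · simp [sieveMatrix]

/-- The span of the rows modulo `p`. -/
def rowSpanMod (Q p : ℕ) (P : Fin i → Fin n → Fin H) : Submodule (ZMod p) (Fin n → ZMod p) :=
  Submodule.span (ZMod p) (Set.range (fun s => reduceMod p (sieveMatrix Q P s)))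

theorem finrank_rowSpanMod_le {p : ℕ} [Fact p.Prime] (P : Fin i → Fin n → Fin H) :
    finrank (ZMod p) (rowSpanMod Q p P) ≤ i :=
  (finrank_range_le_card (R := ZMod p) (fun s => reduceMod p (sieveMatrix Q P s))).trans
    (by rw [Fintype.card_fin])

open Classical in
-- The span of `i ≤ n - 2` rows has codimension at least 2, whence the summable factor `p⁻²`.
theorem card_small_prime_le {p : ℕ} [Fact p.Prime] (hpQ : ¬ p ∣ Q) (hp : p ≤ H) (hi : i + 2 ≤ n)
    (P : Fin i → Fin n → Fin H) :
    ((Finset.univ.filter (fun y : Fin n → Fin H =>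
      reduceMod p (sieveRow Q i y) ∈ rowSpanMod Q p P)).card : ℝ) ≤
      (2 * H) ^ n * ((p : ℝ) ^ 2)⁻¹ := by
  have hp0 : 0 < p := (Fact.out : p.Prime).pos
  have h1 := card_sieveRow_mem_mul_le (i := i) hpQ hp (rowSpanMod Q p P)
  have h2 : p ^ finrank (ZMod p) (rowSpanMod Q p P) ≤ p ^ (n - 2) :=
    Nat.pow_le_pow_right hp0 ((finrank_rowSpanMod_le P).trans (by omega))
  have h3 := h1.trans (Nat.mul_le_mul_right _ h2)
  have h4 : p ^ n = p ^ (n - 2) * p ^ 2 := by rw [← pow_add]; congr 1; omega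
  rw [h4, mul_left_comm] at h3
  have h5 := Nat.le_of_mul_le_mul_left h3 (by positivity)
  rw [← div_eq_mul_inv, le_div_iff₀ (by positivity)]
  exact_mod_cast h5

theorem eq_zero_of_mem_rowSpanMod {p : ℕ} [Fact p.Prime] (h : i ≤ n) (P : Fin i → Fin n → Fin H)
    (hp : ¬ (p : ℤ) ∣ (leadBlock h (sieveMatrix Q P)).det) {w : Fin n → ZMod p}
    (hw : w ∈ rowSpanMod Q p P) (hw0 : ∀ s, w (Fin.castLE h s) = 0) : w = 0 := by
  obtain ⟨c, hc⟩ := (Submodule.mem_span_range_iff_exists_fun _).1 hw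
  have h2 : ∑ s, c s • reduceMod p (leadBlock h (sieveMatrix Q P) s) = 0 := by
    funext t
    have h3 := hw0 t
    rw [← hc, Finset.sum_apply] at h3
    rw [Finset.sum_apply, Pi.zero_apply, ← h3]
    rfl
  have hli := linearIndependent_leadBlock h (sieveMatrix Q P) hp
  rw [Fintype.linearIndependent_iff] at hli
  have h1 : ∀ s, c s = 0 := hli c h2
  rw [← hc]
  exact Finset.sum_eq_zero fun s _ => by rw [h1, zero_smul]

open Classical in
/-- Few new rows make the rows dependent modulo a large prime not dividing the leading minor. -/
theorem card_large_prime_le (hi : i + 1 ≤ n) (P : Fin i → Fin n → Fin H) (hH : 1 ≤ H)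
    (hQ : ∀ p, p.Prime → H < p → ¬ p ∣ Q)
    (hdet : ∀ y : Fin n → Fin H,
      |(leadBlock hi (sieveMatrix Q (Fin.snoc (α := fun _ => Fin n → Fin H) P y))).det| <
      (H : ℤ) ^ (i + 1 + 1)) :
    (Finset.univ.filter (fun y : Fin n → Fin H => ∃ p : ℕ, p.Prime ∧ H < p ∧
      ¬ (p : ℤ) ∣ (leadBlock (Nat.le_of_succ_le hi) (sieveMatrix Q P)).det ∧
      reduceMod p (sieveRow Q i y) ∈ rowSpanMod Q p P)).card ≤ (i + 1) * H ^ (i + 1) := by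
  set S := Finset.univ.filter (fun y : Fin n → Fin H => ∃ p : ℕ, p.Prime ∧ H < p ∧
      ¬ (p : ℤ) ∣ (leadBlock (Nat.le_of_succ_le hi) (sieveMatrix Q P)).det ∧
      reduceMod p (sieveRow Q i y) ∈ rowSpanMod Q p P) with hS
  have hex : ∀ y ∈ S, ∃ p : ℕ, p.Prime ∧ H < p ∧
      ¬ (p : ℤ) ∣ (leadBlock (Nat.le_of_succ_le hi) (sieveMatrix Q P)).det ∧
      reduceMod p (sieveRow Q i y) ∈ rowSpanMod Q p P := fun y hy => (Finset.mem_filter.1 hy).2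
  choose! pf hpf using hex
  -- The first `i + 1` coordinates of `y` fix the next leading minor, which is nonzero and divisible
  -- by every bad prime, so at most `i + 1` primes occur. For each prime, the first `i` coordinates
  -- already determine `y`.
  let res : (Fin n → Fin H) → Fin (i + 1) → Fin H := fun y s => y (Fin.castLE hi s)
  refine (Finset.card_le_mul_card_image (f := res) S (i + 1) ?_).trans ?_
  · intro z hz
    obtain ⟨y₀, hy₀, rfl⟩ := Finset.mem_image.1 hz
    let snocP : (Fin n → Fin H) → Fin (i + 1) → Fin n → Fin H := fun y =>
      Fin.snoc (α := fun _ => Fin n → Fin H) P y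
    have hlead : ∀ y, res y = res y₀ → leadBlock hi (sieveMatrix Q (snocP y)) =
        leadBlock hi (sieveMatrix Q (snocP y₀)) := by
      intro y hy
      ext s t
      have h1 : snocP y s (Fin.castLE hi t) = snocP y₀ s (Fin.castLE hi t) := by
        refine Fin.lastCases ?_ (fun s => ?_) s
        · simpa [snocP] using congrFun hy t
        · simp [snocP]
      simp only [leadBlock, submatrix_apply, sieveMatrix, sieveRow, id, h1]
    set d := (leadBlock hi (sieveMatrix Q (snocP y₀))).det with hd
    have hd0 : d ≠ 0 := det_leadBlock_ne_zero hi _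
    refine le_trans ?_ (card_large_primeFactors_le hd0 hH (hdet y₀))
    apply Finset.card_le_card_of_injOn pf
    · intro y hy
      obtain ⟨hyS, hyr⟩ := Finset.mem_filter.1 (Finset.mem_coe.1 hy)
      obtain ⟨hp, hHp, -, hmem⟩ := hpf y hyS
      have := Fact.mk hp
      rw [Finset.mem_coe, Finset.mem_filter, Nat.mem_primeFactors]
      refine ⟨⟨hp, ?_, Int.natAbs_ne_zero.2 hd0⟩, hHp⟩
      rw [← Int.natCast_dvd]
      by_contra hnd
      rw [hd, ← hlead y hyr] at hnd
      have h2 := linearIndependent_of_leadBlock hi _ hnd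
      rw [reduceMod_sieveMatrix_snoc, linearIndependent_finSnoc] at h2
      exact h2.2 hmem
    · intro y hy y' hy' hyy
      obtain ⟨hyS, hyr⟩ := Finset.mem_filter.1 (Finset.mem_coe.1 hy)
      obtain ⟨hyS', hyr'⟩ := Finset.mem_filter.1 (Finset.mem_coe.1 hy')
      obtain ⟨hp, hHp, hnd, hmem⟩ := hpf y hyS
      obtain ⟨-, -, -, hmem'⟩ := hpf y' hyS'
      rw [← hyy] at hmem'
      have := Fact.mk hp
      apply eq_of_sieveRow_reduceMod_eq (hQ _ hp hHp) hHp (i := i)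
      rw [← sub_eq_zero]
      apply eq_zero_of_mem_rowSpanMod _ P hnd (Submodule.sub_mem _ hmem hmem')
      intro s
      rw [Pi.sub_apply, sub_eq_zero, sieveRow_reduceMod_eq_iff (hQ _ hp hHp)]
      have := congrFun (hyr.trans hyr'.symm) (Fin.castSucc s)
      exact congrArg (fun t : Fin H => ((t : ℕ) : ZMod (pf y))) this
  · refine Nat.mul_le_mul_left _ ((Finset.card_le_univ _).trans (le_of_eq ?_))
    simp

open Classical in
/-- At most half of the new rows fail to extend unimodular rows. -/
theorem card_not_rowsUnimodular_snoc_le (hi : i + 2 ≤ n) (hQ : Q = (2 ^ (n + 3)).factorial)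
    (hH : 8 * n ≤ H) (hH' : n.factorial * (4 * n * Q) ^ n < H) (P : Fin i → Fin n → Fin H)
    (hP : RowsUnimodular (sieveMatrix Q P)) :
    2 * (Finset.univ.filter (fun y : Fin n → Fin H =>
      ¬ RowsUnimodular (sieveMatrix Q (Fin.snoc (α := fun _ => Fin n → Fin H) P y)))).card
      ≤ H ^ n := by
  have hn : 1 ≤ n := by omega
  have hH1 : 1 ≤ H := by omega
  have hQ1 : 1 ≤ Q := hQ ▸ Nat.factorial_pos _
  have hpQ : ∀ p : ℕ, p.Prime → (p ∣ Q ↔ p ≤ 2 ^ (n + 3)) := fun p hp => hQ ▸ hp.dvd_factorial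
  have hQbig : 2 ^ (n + 3) ≤ H := by
    have h1 : 2 ^ (n + 3) ≤ Q := hQ ▸ Nat.self_le_factorial _
    have h2 : Q ≤ 4 * n * Q := Nat.le_mul_of_pos_left _ (by positivity)
    have h3 : 4 * n * Q ≤ (4 * n * Q) ^ n := Nat.le_self_pow (by omega) _
    have h4 : (4 * n * Q) ^ n ≤ n.factorial * (4 * n * Q) ^ n :=
      Nat.le_mul_of_pos_left _ (Nat.factorial_pos _)
    omega
  have hdet : ∀ (j : ℕ) (hj : j ≤ n) (P : Fin j → Fin n → Fin H),
      |(leadBlock hj (sieveMatrix Q P)).det| < (H : ℤ) ^ (j + 1) := by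
    intro j hj P
    refine (abs_det_leadBlock_le hn hQ1 hH1 hj P).trans_lt ?_
    rw [pow_succ' (H : ℤ)]
    exact mul_lt_mul_of_pos_right (by exact_mod_cast hH') (by positivity)
  set d := (leadBlock (show i ≤ n by omega) (sieveMatrix Q P)).det with hd
  have hd0 : d ≠ 0 := det_leadBlock_ne_zero _ _
  let R : ℕ → Finset (Fin n → Fin H) := fun p => Finset.univ.filter
    (fun y => reduceMod p (sieveRow Q i y) ∈ rowSpanMod Q p P)
  -- Bad rows are split by the prime at fault: up to `H`; above `H` and dividing the current minor
  -- `d`; above `H` and not dividing `d`. Primes up to `2^(n+3)` divide `Q`.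
  let B₁ := ((Finset.Ioo (2 ^ (n + 3)) (H + 1)).filter Nat.Prime).biUnion R
  let B₂ := (d.natAbs.primeFactors.filter (fun p => H < p)).biUnion R
  let B₃ := Finset.univ.filter (fun y : Fin n → Fin H => ∃ p : ℕ, p.Prime ∧ H < p ∧
      ¬ (p : ℤ) ∣ d ∧ reduceMod p (sieveRow Q i y) ∈ rowSpanMod Q p P)
  have hsub : Finset.univ.filter (fun y : Fin n → Fin H =>
      ¬ RowsUnimodular (sieveMatrix Q (Fin.snoc (α := fun _ => Fin n → Fin H) P y)))
      ⊆ B₁ ∪ (B₂ ∪ B₃) := by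
    intro y hy
    have hy' := (Finset.mem_filter.1 hy).2
    unfold RowsUnimodular at hy'
    push Not at hy'
    obtain ⟨p, hp, hli⟩ := hy'
    have := Fact.mk hp
    have hpd : ¬ p ∣ Q := fun hdvd =>
      hli (linearIndependent_of_leadBlock (show i + 1 ≤ n by omega) _
        (not_dvd_det_leadBlock_of_dvd _ hdvd _))
    rw [reduceMod_sieveMatrix_snoc, linearIndependent_finSnoc] at hli
    have hmem : reduceMod p (sieveRow Q i y) ∈ rowSpanMod Q p P := by
      by_contra hc
      exact hli ⟨hP p hp, hc⟩
    have hyR : y ∈ R p := Finset.mem_filter.2 ⟨Finset.mem_univ _, hmem⟩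
    rw [hpQ p hp, not_le] at hpd
    rw [Finset.mem_union, Finset.mem_union]
    by_cases hpH : p ≤ H
    · left
      refine Finset.mem_biUnion.2 ⟨p, ?_, hyR⟩
      rw [Finset.mem_filter, Finset.mem_Ioo]
      exact ⟨⟨hpd, by omega⟩, hp⟩
    · rw [not_le] at hpH
      right
      by_cases hpdet : (p : ℤ) ∣ d
      · left
        refine Finset.mem_biUnion.2 ⟨p, ?_, hyR⟩
        rw [Finset.mem_filter, Nat.mem_primeFactors]
        exact ⟨⟨hp, Int.natCast_dvd.1 hpdet, Int.natAbs_ne_zero.2 hd0⟩, hpH⟩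
      · right
        exact Finset.mem_filter.2 ⟨Finset.mem_univ _, p, hp, hpH, hpdet, hmem⟩
  have hlarge : ∀ p, p.Prime → H < p → ¬ p ∣ Q := by
    intro p hp hHp hdvd
    rw [hpQ p hp] at hdvd
    omega
  -- The cutoff `2^(n+3)` makes the tail of `∑ p⁻²` absorb the factor `2^n`; `B₂` and `B₃` get `H^n
  -- / 8` each, for a total of one half.
  have hB₁ : (B₁.card : ℝ) ≤ (H : ℝ) ^ n / 4 := by
    have h1 : (B₁.card : ℝ) ≤
        ∑ p ∈ (Finset.Ioo (2 ^ (n + 3)) (H + 1)).filter Nat.Prime, ((R p).card : ℝ) := by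
      exact_mod_cast Finset.card_biUnion_le
    refine h1.trans ?_
    calc ∑ p ∈ (Finset.Ioo (2 ^ (n + 3)) (H + 1)).filter Nat.Prime, ((R p).card : ℝ)
        ≤ ∑ p ∈ (Finset.Ioo (2 ^ (n + 3)) (H + 1)).filter Nat.Prime,
            (2 * (H : ℝ)) ^ n * ((p : ℝ) ^ 2)⁻¹ := by
          apply Finset.sum_le_sum
          intro p hp
          rw [Finset.mem_filter, Finset.mem_Ioo] at hp
          have := Fact.mk hp.2
          refine card_small_prime_le (fun h => ?_) (by omega) hi P
          rw [hpQ p hp.2] at h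
          omega
      _ ≤ ∑ p ∈ Finset.Ioo (2 ^ (n + 3)) (H + 1), (2 * (H : ℝ)) ^ n * ((p : ℝ) ^ 2)⁻¹ :=
          Finset.sum_le_sum_of_subset_of_nonneg (Finset.filter_subset _ _)
            (fun _ _ _ => by positivity)
      _ ≤ (2 * (H : ℝ)) ^ n * (2 / ((2 ^ (n + 3) : ℕ) + 1)) := by
          rw [← Finset.mul_sum]
          exact mul_le_mul_of_nonneg_left (sum_Ioo_inv_sq_le _ _) (by positivity)
      _ ≤ (2 * (H : ℝ)) ^ n * (2 / 2 ^ (n + 3)) := by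
          gcongr
          push_cast
          linarith
      _ = (H : ℝ) ^ n / 4 := by
          rw [mul_pow, pow_add]
          field_simp
          norm_num
  have hB₂ : B₂.card ≤ n * H ^ (n - 1) := by
    refine Finset.card_biUnion_le.trans ((Finset.sum_le_card_nsmul _ _ (H ^ (n - 1)) ?_).trans ?_)
    · intro p hp
      rw [Finset.mem_filter, Nat.mem_primeFactors] at hp
      have := Fact.mk hp.1.1
      refine (card_sieveRow_mem_le (hlarge p hp.1.1 hp.2) hp.2 hH1 _).trans ?_
      exact Nat.pow_le_pow_right hH1 ((finrank_rowSpanMod_le P).trans (by omega))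
    · rw [smul_eq_mul]
      exact Nat.mul_le_mul_right _
        ((card_large_primeFactors_le hd0 hH1 (hdet i (by omega) P)).trans (by omega))
  have hB₃ : B₃.card ≤ n * H ^ (n - 1) := by
    refine (card_large_prime_le (show i + 1 ≤ n by omega) P hH1 hlarge
      (fun y => hdet _ (by omega) _)).trans ?_
    exact Nat.mul_le_mul (by omega) (Nat.pow_le_pow_right hH1 (by omega))
  have hpow : 8 * (n * H ^ (n - 1)) ≤ H ^ n := by
    obtain ⟨k, rfl⟩ : ∃ k, n = k + 1 := ⟨n - 1, by omega⟩
    rw [Nat.add_sub_cancel, pow_succ', ← mul_assoc]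
    exact Nat.mul_le_mul_right _ hH
  have hfin : (Finset.univ.filter (fun y : Fin n → Fin H =>
      ¬ RowsUnimodular (sieveMatrix Q (Fin.snoc (α := fun _ => Fin n → Fin H) P y)))).card ≤
      B₁.card + (B₂.card + B₃.card) :=
    (Finset.card_le_card hsub).trans ((Finset.card_union_le _ _).trans
      (Nat.add_le_add_left (Finset.card_union_le _ _) _))
  have h4 : 4 * B₁.card ≤ H ^ n := by
    have : (4 : ℝ) * B₁.card ≤ (H : ℝ) ^ n := by linarith
    exact_mod_cast this
  omega

open Classical in
theorem pow_le_card_rowsUnimodular (hQ : Q = (2 ^ (n + 3)).factorial)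
    (hH : 8 * n ≤ H) (hH' : n.factorial * (4 * n * Q) ^ n < H) (i : ℕ) (hi : i + 1 ≤ n) :
    (H ^ n) ^ i ≤ 2 ^ i * (Finset.univ.filter (fun P : Fin i → Fin n → Fin H =>
      RowsUnimodular (sieveMatrix Q P))).card := by
  induction i with
  | zero =>
    have : (Finset.univ.filter (fun P : Fin 0 → Fin n → Fin H =>
        RowsUnimodular (sieveMatrix Q P))) = Finset.univ := by
      ext P
      simp only [Finset.mem_filter, Finset.mem_univ, true_and, iff_true]
      intro p hp
      exact linearIndependent_empty_type
    rw [this]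
    simp
  | succ i ih =>
    set G := Finset.univ.filter (fun P : Fin i → Fin n → Fin H =>
      RowsUnimodular (sieveMatrix Q P)) with hG
    let E : (Fin i → Fin n → Fin H) → Finset (Fin n → Fin H) := fun P => Finset.univ.filter
      (fun y => RowsUnimodular (sieveMatrix Q (Fin.snoc (α := fun _ => Fin n → Fin H) P y)))
    have hE : ∀ P ∈ G, H ^ n ≤ 2 * (E P).card := by
      intro P hP
      have h1 := card_not_rowsUnimodular_snoc_le hi hQ hH hH' P (Finset.mem_filter.1 hP).2
      have h2 := Finset.card_filter_add_card_filter_not (s := (Finset.univ : Finset (Fin n → Fin H)))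
        (fun y => RowsUnimodular (sieveMatrix Q (Fin.snoc (α := fun _ => Fin n → Fin H) P y)))
      rw [Finset.card_univ, Fintype.card_fun, Fintype.card_fin, Fintype.card_fin] at h2
      simp only [E]
      omega
    have h3 : ∑ P ∈ G, (E P).card ≤ (Finset.univ.filter (fun P : Fin (i + 1) → Fin n → Fin H =>
        RowsUnimodular (sieveMatrix Q P))).card := by
      rw [← Finset.card_sigma]
      apply Finset.card_le_card_of_injOn
        (fun q => Fin.snoc (α := fun _ => Fin n → Fin H) q.1 q.2)
      · rintro ⟨P, y⟩ hq
        rw [Finset.mem_coe, Finset.mem_sigma] at hq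
        exact Finset.mem_coe.2 (Finset.mem_filter.2 ⟨Finset.mem_univ _, (Finset.mem_filter.1 hq.2).2⟩)
      · rintro ⟨P, y⟩ _ ⟨P', y'⟩ _ hq
        obtain ⟨h1, h2⟩ := Fin.snoc_inj.1 hq
        subst h1 h2
        rfl
    have h4 : G.card * H ^ n ≤ 2 * ∑ P ∈ G, (E P).card := by
      rw [Finset.mul_sum, ← smul_eq_mul]
      exact Finset.card_nsmul_le_sum _ _ _ hE
    calc (H ^ n) ^ (i + 1) = (H ^ n) ^ i * H ^ n := pow_succ _ _
      _ ≤ (2 ^ i * G.card) * H ^ n := Nat.mul_le_mul_right _ (ih (by omega))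
      _ = 2 ^ i * (G.card * H ^ n) := mul_assoc _ _ _
      _ ≤ 2 ^ i * (2 * ∑ P ∈ G, (E P).card) := Nat.mul_le_mul_left _ h4
      _ ≤ 2 ^ i * (2 * _) := Nat.mul_le_mul_left _ (Nat.mul_le_mul_left _ h3)
      _ = _ := by rw [← mul_assoc, ← pow_succ]

end Sieve

/-! ### Bounded multiplicity of the map `B ↦ Bᵀ J B`. -/

section Sieve

open Matrix

variable {n H i m Q : ℕ}

/-- Independence modulo `p` strips off one prime factor of `d` at a time: the row lattice is
saturated. -/
theorem RowsUnimodular.dvd {B : Matrix (Fin m) (Fin n) ℤ} (hB : RowsUnimodular B) (d : ℕ) :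
    d ≠ 0 → ∀ b : Fin m → ℤ, (∀ j, (d : ℤ) ∣ (b ᵥ* B) j) → ∀ s, (d : ℤ) ∣ b s := by
  induction d using induction_on_primes with
  | zero => intro h; exact absurd rfl h
  | one => intro _ b _ s; simp
  | prime_mul p a hp ih =>
    intro hpa b hb s
    have := Fact.mk hp
    have ha : a ≠ 0 := by rintro rfl; simp at hpa
    have h1 : ∀ s, (p : ℤ) ∣ b s := by
      have hli := hB p hp
      rw [Fintype.linearIndependent_iff] at hli
      have h2 := hli (fun s => (b s : ZMod p)) (by
        funext j
        have h3 : (p : ℤ) ∣ (b ᵥ* B) j := (Dvd.intro _ (by push_cast; rfl)).trans (hb j)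
        rw [← ZMod.intCast_zmod_eq_zero_iff_dvd] at h3
        rw [Finset.sum_apply, Pi.zero_apply, ← h3]
        simp [vecMul, dotProduct, reduceMod])
      intro s
      exact (ZMod.intCast_zmod_eq_zero_iff_dvd _ _).1 (h2 s)
    choose b' hb' using h1
    have hbb : b = (p : ℤ) • b' := by ext s; simp [hb']
    have hp0 : (p : ℤ) ≠ 0 := by exact_mod_cast hp.ne_zero
    have h4 := ih ha b' (fun j => by
      have := hb j
      rw [hbb, smul_vecMul, Pi.smul_apply, smul_eq_mul, Nat.cast_mul] at this
      exact (mul_dvd_mul_iff_left hp0).1 this) s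
    rw [hb', Nat.cast_mul]
    exact mul_dvd_mul_left _ h4

theorem sieveMatrix_injective (hQ : 1 ≤ Q) :
    Function.Injective (fun P : Fin i → Fin n → Fin H => sieveMatrix Q P) := by
  intro P P' h
  ext s j
  have h1 := congrFun (congrFun h s) j
  have hQ0 : (Q : ℤ) ≠ 0 := by exact_mod_cast (by omega : Q ≠ 0)
  simp only [sieveMatrix, sieveRow, add_right_inj] at h1
  exact_mod_cast mul_left_cancel₀ hQ0 h1

/-- Two unimodular factorizations of the same form differ by a small integral matrix. -/
theorem exists_mul_eq_of_form_eq (hmn : m ≤ n) (hQ : 1 ≤ Q) (hH : 1 ≤ H)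
    {J : Matrix (Fin m) (Fin m) ℤ} (hJ : J.det ≠ 0) {P P' : Fin m → Fin n → Fin H}
    (hP : RowsUnimodular (sieveMatrix Q P))
    (h : (sieveMatrix Q P)ᵀ * J * sieveMatrix Q P = (sieveMatrix Q P')ᵀ * J * sieveMatrix Q P') :
    ∃ g : Matrix (Fin m) (Fin m) ℤ, sieveMatrix Q P' = g * sieveMatrix Q P ∧
      ∀ s t, g s t ∈ Finset.Icc (-3 : ℤ) 3 := by
  set B := sieveMatrix Q P with hB
  set B' := sieveMatrix Q P' with hB'
  set N := (leadBlock hmn B')ᵀ * J with hN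
  have h1 : (leadBlock hmn B)ᵀ * J * B = N * B' :=
    congrArg (fun A => A.submatrix (Fin.castLE hmn) id) h
  have hd : N.det ≠ 0 := by
    rw [hN, det_mul, det_transpose]
    exact mul_ne_zero (det_leadBlock_ne_zero _ _) hJ
  -- Over `ℚ`, `B' = N⁻¹ (leadBlock B)ᵀ J B`. Clearing the denominator `det N`, unimodularity of `B`
  -- makes the quotient integral.
  set C := N.adjugate * ((leadBlock hmn B)ᵀ * J) with hC
  have h2 : N.det • B' = C * B := by
    rw [hC, Matrix.mul_assoc, h1, ← Matrix.mul_assoc, adjugate_mul, smul_mul, Matrix.one_mul]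
  have h3 : ∀ s t, N.det ∣ C s t := by
    intro s t
    rw [← Int.natAbs_dvd]
    refine hP.dvd N.det.natAbs (Int.natAbs_ne_zero.2 hd) (C s) (fun j => ?_) t
    rw [Int.natAbs_dvd]
    have h4 := congrFun (congrFun h2 s) j
    refine ⟨B' s j, ?_⟩
    rw [← smul_eq_mul]
    exact h4.symm
  obtain ⟨g, hCg⟩ : ∃ g : Matrix (Fin m) (Fin m) ℤ, C = N.det • g := by
    choose g hg using h3
    exact ⟨Matrix.of g, by ext s t; exact hg s t⟩
  have h5 : B' = g * B := by
    rw [hCg, smul_mul] at h2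
    exact smul_right_injective _ hd h2
  refine ⟨g, h5, fun s t => ?_⟩
  have hn : 1 ≤ n := by have := t.2; omega
  -- The leading block of `g B` is that of `B'`, with entries at most `1 + 2nQH + QH < 4 (1 + nQH)`;
  -- dominance then gives `|g s t| < 4`.
  have h6 := abs_mul_le_of_vecMul_leadBlock hmn P (g s) (1 + 2 * n * Q * H + Q * H) (by
    intro t
    have h7 : (g s ᵥ* leadBlock hmn B) t = B' s (Fin.castLE hmn t) := by
      rw [h5]; rfl
    rw [h7]
    exact abs_sieveMatrix_le hn hQ hH P' _ _) t
  have h8 : (1 : ℤ) * (Q * H) ≤ n * (Q * H) := by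
    have : (1 : ℤ) ≤ n := by exact_mod_cast hn
    gcongr
  have h9 : (0 : ℤ) ≤ Q * H := by positivity
  rw [Finset.mem_Icc, ← abs_le]
  by_contra! hlt
  have h10 : (4 : ℤ) ≤ |g s t| := hlt
  have h11 : 4 * (1 + n * Q * H : ℤ) ≤ |g s t| * (1 + n * Q * H) := by gcongr
  nlinarith

open Classical in
theorem card_rowsUnimodular_le (hmn : m ≤ n) (hQ : 1 ≤ Q) (hH : 1 ≤ H)
    {J : Matrix (Fin m) (Fin m) ℤ} (hJ : J.det ≠ 0) :
    (Finset.univ.filter (fun P : Fin m → Fin n → Fin H =>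
      RowsUnimodular (sieveMatrix Q P))).card ≤ 7 ^ (m * m) *
    ((Finset.univ.filter (fun P : Fin m → Fin n → Fin H =>
      RowsUnimodular (sieveMatrix Q P))).image
        (fun P => (sieveMatrix Q P)ᵀ * J * sieveMatrix Q P)).card := by
  apply Finset.card_le_mul_card_image
  intro A hA
  obtain ⟨P, hP, rfl⟩ := Finset.mem_image.1 hA
  have hPu := (Finset.mem_filter.1 hP).2
  set S := (Finset.univ.filter (fun P : Fin m → Fin n → Fin H =>
      RowsUnimodular (sieveMatrix Q P))).filter (fun P' =>
        (sieveMatrix Q P')ᵀ * J * sieveMatrix Q P' = (sieveMatrix Q P)ᵀ * J * sieveMatrix Q P) with hS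
  have hex : ∀ P' ∈ S, ∃ g : Matrix (Fin m) (Fin m) ℤ, sieveMatrix Q P' = g * sieveMatrix Q P ∧
      ∀ s t, g s t ∈ Finset.Icc (-3 : ℤ) 3 := fun P' hP' =>
    exists_mul_eq_of_form_eq hmn hQ hH hJ hPu (Finset.mem_filter.1 hP').2.symm
  choose! g hg using hex
  have hcard : (7 : ℕ) ^ (m * m) = (Fintype.piFinset (fun _ : Fin m =>
      Fintype.piFinset (fun _ : Fin m => Finset.Icc (-3 : ℤ) 3))).card := by
    simp [Fintype.card_piFinset, pow_mul]
  rw [hcard]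
  apply Finset.card_le_card_of_injOn g
  · intro P' hP'
    exact Finset.mem_coe.2 (Fintype.mem_piFinset.2 fun s =>
      Fintype.mem_piFinset.2 ((hg P' hP').2 s))
  · intro P' hP' P'' hP'' hgg
    apply sieveMatrix_injective hQ
    simp only
    rw [(hg P' hP').1, (hg P'' hP'').1, hgg]

end Sieve

/-! ### The lower bound for matrices of low rank. -/

section LowerBound

open Matrix

theorem exists_unimodular_alternating (k : ℕ) : ∃ J : Matrix (Fin (2 * k)) (Fin (2 * k)) ℤ,
    Jᵀ = -J ∧ J.det ≠ 0 ∧ ∀ s t, |J s t| ≤ 1 := by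
  let e : Fin k ⊕ Fin k ≃ Fin (2 * k) := finSumFinEquiv.trans (finCongr (two_mul k).symm)
  refine ⟨(Matrix.J (Fin k) ℤ).submatrix e.symm e.symm, ?_, ?_, ?_⟩
  · rw [transpose_submatrix, J_transpose]; rfl
  · rw [det_submatrix_equiv_self]
    exact (isUnit_det_J (Fin k) ℤ).ne_zero
  · intro s t
    rw [submatrix_apply]
    rcases e.symm s with a | a <;> rcases e.symm t with b | b <;>
      simp only [Matrix.J, fromBlocks_apply₁₁, fromBlocks_apply₁₂, fromBlocks_apply₂₁,
        fromBlocks_apply₂₂, Matrix.neg_apply, one_apply, Matrix.zero_apply] <;> (try split_ifs) <;> simp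

theorem le_kerRank_of_factor {n m : ℕ} (B : Matrix (Fin m) (Fin n) ℤ)
    (C : Matrix (Fin n) (Fin m) ℤ) :
    n ≤ kerRank (C * B) + m := by
  have h1 : LinearMap.ker B.mulVecLin ≤ LinearMap.ker (C * B).mulVecLin := by
    rw [mulVecLin_mul]
    exact LinearMap.ker_le_ker_comp _ _
  have h2 := Submodule.finrank_mono h1
  have h3 := Submodule.finrank_quotient_add_finrank (LinearMap.ker B.mulVecLin)
  rw [LinearEquiv.finrank_eq B.mulVecLin.quotKerEquivRange] at h3
  have h4 := Submodule.finrank_le (LinearMap.range B.mulVecLin)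
  rw [finrank_fintype_fun_eq_card, Fintype.card_fin] at h3 h4
  unfold kerRank
  omega

/-- The lower bound for the number of alternating matrices with large kernel. -/
theorem exists_le_ncard_kerRank (n r k : ℕ) (hr : 1 ≤ r) (hn : n = r + 2 * k) : ∃ c : ℝ, 0 < c ∧
    ∀ X : ℝ, 1 ≤ X → c * X ^ (n * k) ≤
      ({A ∈ altMatricesLE n X | r ≤ kerRank A}.ncard : ℝ) := by
  classical
  obtain ⟨J, hJt, hJd, hJ1⟩ := exists_unimodular_alternating k
  set Q := (2 ^ (n + 3)).factorial with hQ
  have hQ1 : 1 ≤ Q := Nat.factorial_pos _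
  have hn1 : 1 ≤ n := by omega
  -- Entries of `Bᵀ J B` are at most `(2k)² (4nQH)² ≤ (wH)²`, so `H` may be as large as `√X / w`.
  set w : ℕ := 4 * n * n * Q with hw
  have hw1 : 1 ≤ w := Nat.mul_pos (Nat.mul_pos (by omega) hn1) hQ1
  set H₀ : ℕ := 8 * n + n.factorial * (4 * n * Q) ^ n + 1 with hH₀
  have hwR : (1 : ℝ) ≤ w := by exact_mod_cast hw1
  set c₁ : ℝ := ((2 * w : ℝ) ^ (2 * (n * k)))⁻¹ / (2 ^ (2 * k) * 7 ^ (2 * k * (2 * k))) with hc₁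
  set c₂ : ℝ := (((w * H₀ : ℝ) ^ 2) ^ (n * k))⁻¹ with hc₂
  have hH₀R : (1 : ℝ) ≤ H₀ := by
    rw [hH₀]
    have : (0 : ℝ) ≤ 8 * n + n.factorial * (4 * n * Q) ^ n := by positivity
    push_cast
    linarith
  have hc₁pos : 0 < c₁ := by positivity
  have hc₂pos : 0 < c₂ := by positivity
  refine ⟨min c₁ c₂, lt_min hc₁pos hc₂pos, fun X hX => ?_⟩
  have hX0 : 0 ≤ X := by linarith
  have hfin : {A ∈ altMatricesLE n X | r ≤ kerRank A}.Finite :=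
    (altMatricesLE_finite n X).subset (fun A hA => hA.1)
  -- For bounded `X` the zero matrix suffices; otherwise `H ≥ H₀` and the sieve applies.
  rcases le_or_gt X ((w * H₀ : ℝ) ^ 2) with hsmall | hlarge
  · have h0 : (0 : Matrix (Fin n) (Fin n) ℤ) ∈ {A ∈ altMatricesLE n X | r ≤ kerRank A} := by
      refine ⟨⟨by simp, by simpa using fun _ _ => hX0⟩, ?_⟩
      have h1 := le_kerRank_of_factor (0 : Matrix (Fin (2 * k)) (Fin n) ℤ) 0
      rw [Matrix.mul_zero] at h1
      omega
    have h1 : 1 ≤ {A ∈ altMatricesLE n X | r ≤ kerRank A}.ncard :=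
      (Set.ncard_pos hfin).2 ⟨0, h0⟩
    calc min c₁ c₂ * X ^ (n * k) ≤ c₂ * ((w * H₀ : ℝ) ^ 2) ^ (n * k) := by
          gcongr; exact min_le_right _ _
      _ = 1 := inv_mul_cancel₀ (by positivity)
      _ ≤ _ := by exact_mod_cast h1
  · set H : ℕ := ⌊Real.sqrt X / w⌋₊ with hH
    have hsq : (w * H₀ : ℝ) < Real.sqrt X := Real.lt_sqrt_of_sq_lt hlarge
    have hdiv : (H₀ : ℝ) ≤ Real.sqrt X / w := by
      rw [le_div_iff₀ (by positivity)]; linarith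
    have hH₀H : H₀ ≤ H := Nat.le_floor hdiv
    have hH1 : 1 ≤ H := by omega
    have hwH : (w * H : ℝ) ≤ Real.sqrt X := by
      have : (H : ℝ) ≤ Real.sqrt X / w := Nat.floor_le (by positivity)
      rwa [le_div_iff₀ (by positivity), mul_comm] at this
    have hHlow : Real.sqrt X ≤ 2 * w * H := by
      have h1 : Real.sqrt X / w < H + 1 := Nat.lt_floor_add_one _
      rw [div_lt_iff₀ (by positivity)] at h1
      have h2 : (1 : ℝ) ≤ H := by exact_mod_cast hH1
      nlinarith
    set G := Finset.univ.filter (fun P : Fin (2 * k) → Fin n → Fin H =>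
      RowsUnimodular (sieveMatrix Q P)) with hG
    set 𝒜 := G.image (fun P => (sieveMatrix Q P)ᵀ * J * sieveMatrix Q P) with h𝒜
    have hcount := pow_le_card_rowsUnimodular hQ (by omega) (by omega) (2 * k) (by omega) (H := H)
    have hfibre := card_rowsUnimodular_le (m := 2 * k) (by omega) hQ1 hH1 hJd (n := n)
    have hcard : ((H : ℝ) ^ n) ^ (2 * k) ≤ 2 ^ (2 * k) * (7 ^ (2 * k * (2 * k)) * 𝒜.card) := by
      have := hcount.trans (Nat.mul_le_mul_left _ hfibre)
      exact_mod_cast this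
    have hsub : (𝒜 : Set (Matrix (Fin n) (Fin n) ℤ)) ⊆ {A ∈ altMatricesLE n X | r ≤ kerRank A} := by
      intro A hA
      obtain ⟨P, -, rfl⟩ := Finset.mem_image.1 (Finset.mem_coe.1 hA)
      refine ⟨⟨?_, ?_⟩, ?_⟩
      · rw [transpose_mul, transpose_mul, transpose_transpose, hJt, ← Matrix.mul_assoc]
        simp
      · intro a b
        have hent : |((sieveMatrix Q P)ᵀ * J * sieveMatrix Q P) a b| ≤ (w * H : ℤ) ^ 2 := by
          have hb : ∀ s j, |sieveMatrix Q P s j| ≤ 4 * n * Q * H :=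
            abs_sieveMatrix_le' hn1 hQ1 hH1 P
          have hkn : ((2 * k : ℕ) : ℤ) ≤ n := by exact_mod_cast (by omega : 2 * k ≤ n)
          have h1 : ∀ t, |((sieveMatrix Q P)ᵀ * J) a t| ≤ n * (4 * n * Q * H) := by
            intro t
            rw [mul_apply]
            refine (Finset.abs_sum_le_sum_abs _ _).trans ((Finset.sum_le_card_nsmul _ _
              (4 * n * Q * H : ℤ) ?_).trans ?_)
            · intro s _
              rw [abs_mul, transpose_apply]
              have := mul_le_mul (hb s a) (hJ1 s t) (abs_nonneg _) (by positivity)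
              rwa [mul_one] at this
            · rw [Finset.card_univ, Fintype.card_fin, nsmul_eq_mul]
              gcongr
          rw [mul_apply]
          refine (Finset.abs_sum_le_sum_abs _ _).trans ((Finset.sum_le_card_nsmul _ _
              ((n * (4 * n * Q * H)) * (4 * n * Q * H) : ℤ) ?_).trans ?_)
          · intro s _
            rw [abs_mul]
            exact mul_le_mul (h1 s) (hb s b) (abs_nonneg _) (by positivity)
          · rw [Finset.card_univ, Fintype.card_fin, nsmul_eq_mul]
            refine (mul_le_mul_of_nonneg_right hkn (by positivity)).trans (le_of_eq ?_)
            rw [hw]; push_cast; ring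
        have hent' : |((((sieveMatrix Q P)ᵀ * J * sieveMatrix Q P) a b : ℤ) : ℝ)| ≤
            (w * H : ℝ) ^ 2 := by
          exact_mod_cast hent
        refine hent'.trans ?_
        calc (w * H : ℝ) ^ 2 ≤ Real.sqrt X ^ 2 := by gcongr
          _ = X := Real.sq_sqrt hX0
      · have := le_kerRank_of_factor (sieveMatrix Q P) ((sieveMatrix Q P)ᵀ * J)
        omega
    have hle : (𝒜.card : ℝ) ≤ ({A ∈ altMatricesLE n X | r ≤ kerRank A}.ncard : ℝ) := by
      rw [← Set.ncard_coe_finset]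
      exact_mod_cast Set.ncard_le_ncard hsub hfin
    refine le_trans ?_ hle
    have hXpow : X ^ (n * k) ≤ (2 * w : ℝ) ^ (2 * (n * k)) * ((H : ℝ) ^ n) ^ (2 * k) := by
      calc X ^ (n * k) = Real.sqrt X ^ (2 * (n * k)) := by
            rw [pow_mul (Real.sqrt X) 2, Real.sq_sqrt hX0]
        _ ≤ (2 * w * H) ^ (2 * (n * k)) := by gcongr
        _ = _ := by rw [mul_pow, ← pow_mul]; congr 2; ring
    calc min c₁ c₂ * X ^ (n * k) ≤ c₁ * ((2 * w : ℝ) ^ (2 * (n * k)) *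
          (2 ^ (2 * k) * (7 ^ (2 * k * (2 * k)) * 𝒜.card))) := by
          gcongr
          · exact min_le_left _ _
          · exact hXpow.trans (by gcongr)
      _ = 𝒜.card := by
          rw [hc₁]
          field_simp

end LowerBound

/-! ### The upper bound: integer matrices as forms on Euclidean space. -/

section UpperBound

open Matrix

/-- The vectors with integral coordinates. -/
def integerLattice (n : ℕ) : AddSubgroup (EuclideanSpace ℝ (Fin n)) where
  carrier := {x | ∀ i, ∃ z : ℤ, x i = z}
  zero_mem' := fun i => ⟨0, by simp⟩
  add_mem' := by
    intro a b ha hb i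
    obtain ⟨z, hz⟩ := ha i
    obtain ⟨w, hw⟩ := hb i
    exact ⟨z + w, by rw [PiLp.add_apply, hz, hw]; push_cast; rfl⟩
  neg_mem' := by
    intro a ha i
    obtain ⟨z, hz⟩ := ha i
    exact ⟨-z, by rw [PiLp.neg_apply, hz]; push_cast; rfl⟩

theorem single_mem_integerLattice {n : ℕ} (i : Fin n) :
    EuclideanSpace.single i (1 : ℝ) ∈ integerLattice n := by
  intro j
  by_cases h : j = i
  · exact ⟨1, by simp [h]⟩
  · exact ⟨0, by simp [h]⟩

theorem span_integerLattice (n : ℕ) :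
    Submodule.span ℝ (integerLattice n : Set (EuclideanSpace ℝ (Fin n))) = ⊤ := by
  rw [eq_top_iff, ← (EuclideanSpace.basisFun (Fin n) ℝ).toBasis.span_eq]
  apply Submodule.span_mono
  rintro _ ⟨i, rfl⟩
  simpa using single_mem_integerLattice i

theorem exists_int_of_mem_dualLattice {n : ℕ} {x : EuclideanSpace ℝ (Fin n)}
    (hx : x ∈ dualLattice (integerLattice n)) (i : Fin n) : ∃ z : ℤ, x i = z := by
  obtain ⟨z, hz⟩ := hx _ (single_mem_integerLattice i)
  exact ⟨z, by rw [← hz, EuclideanSpace.inner_single_right]; simp⟩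

theorem mem_dualLattice_of_int {n : ℕ} {x : EuclideanSpace ℝ (Fin n)}
    (hx : ∀ i, ∃ z : ℤ, x i = z) : x ∈ dualLattice (integerLattice n) := by
  intro m hm
  choose z hz using hx
  choose w hw using hm
  refine ⟨∑ i, w i * z i, ?_⟩
  rw [PiLp.inner_apply]
  push_cast
  refine Finset.sum_congr rfl fun i _ => ?_
  simp [hz, hw]

theorem one_le_norm_of_mem_dualLattice {n : ℕ} {x : EuclideanSpace ℝ (Fin n)}
    (hx : x ∈ dualLattice (integerLattice n)) (hx0 : x ≠ 0) : 1 ≤ ‖x‖ := by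
  obtain ⟨i, hi⟩ : ∃ i, x i ≠ 0 := by
    by_contra! h
    exact hx0 (by ext i; simpa using h i)
  obtain ⟨z, hz⟩ := exists_int_of_mem_dualLattice hx i
  have hz0 : z ≠ 0 := by rintro rfl; simp [hz] at hi
  have h1 : (1 : ℝ) ≤ |(z : ℝ)| := by exact_mod_cast Int.one_le_abs hz0
  have h2 := PiLp.norm_apply_le x i
  rw [Real.norm_eq_abs, hz] at h2
  linarith

theorem countBound_dual_integerLattice (n : ℕ) :
    CountBound (dualLattice (integerLattice n) : Set (EuclideanSpace ℝ (Fin n))) n (3 ^ n) := by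
  classical
  intro x ρ hρ P hP
  have hex : ∀ y ∈ P, ∃ z : Fin n → ℤ, ∀ i, y i = z i := fun y hy => by
    have := exists_int_of_mem_dualLattice (hP y hy).1
    choose z hz using this
    exact ⟨z, hz⟩
  choose! z hz using hex
  have h1 : P.card ≤ (Fintype.piFinset (fun i : Fin n =>
      Finset.Icc ⌈x i - ρ⌉ ⌊x i + ρ⌋)).card := by
    apply Finset.card_le_card_of_injOn z
    · intro y hy
      refine Finset.mem_coe.2 (Fintype.mem_piFinset.2 fun i => ?_)
      have h2 := (PiLp.norm_apply_le (y - x) i).trans (hP y hy).2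
      rw [PiLp.sub_apply, hz y hy i, Real.norm_eq_abs, abs_le] at h2
      rw [Finset.mem_Icc, Int.ceil_le, Int.le_floor]
      constructor <;> linarith
    · intro y hy y' hy' h
      ext i
      rw [hz y hy, hz y' hy', h]
  have h2 : ((Fintype.piFinset (fun i : Fin n =>
      Finset.Icc ⌈x i - ρ⌉ ⌊x i + ρ⌋)).card : ℝ) ≤ (3 * ρ) ^ n := by
    rw [Fintype.card_piFinset]
    push_cast
    refine (Finset.prod_le_prod (g := fun _ => 3 * ρ) (fun _ _ => Nat.cast_nonneg _) ?_).trans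
      (by simp)
    intro i _
    rw [Int.card_Icc]
    have h3 : ⌈x i - ρ⌉ ≤ ⌊x i + ρ⌋ + 1 := by
      rw [Int.ceil_le]
      have := Int.lt_floor_add_one (x i + ρ)
      push_cast
      linarith
    rw [← Int.cast_natCast, Int.toNat_of_nonneg (by omega)]
    push_cast
    have := Int.floor_le (x i + ρ)
    have := Int.le_ceil (x i - ρ)
    linarith
  rw [← mul_pow]
  exact le_trans (by exact_mod_cast h1) h2

/-- The endomorphism of Euclidean space given by an integer matrix. -/
noncomputable def realForm {n : ℕ} (A : Matrix (Fin n) (Fin n) ℤ) :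
    EuclideanSpace ℝ (Fin n) →ₗ[ℝ] EuclideanSpace ℝ (Fin n) :=
  Matrix.toEuclideanLin (A.map (fun z : ℤ => (z : ℝ)))

variable {n : ℕ} {A : Matrix (Fin n) (Fin n) ℤ}

theorem realForm_apply (x : EuclideanSpace ℝ (Fin n)) (i : Fin n) :
    realForm A x i = ∑ j, (A i j : ℝ) * x j := by
  simp [realForm, Matrix.toLpLin_apply, mulVec, dotProduct]

theorem realForm_injective :
    Function.Injective (realForm : Matrix (Fin n) (Fin n) ℤ → _) := by
  intro A B h
  ext i j
  have h1 := congrArg (fun f => f (EuclideanSpace.single j (1 : ℝ)) i) h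
  simp only [realForm_apply, PiLp.single_apply, mul_ite, mul_one, mul_zero, Finset.sum_ite_eq',
    Finset.mem_univ, if_true] at h1
  exact_mod_cast h1

theorem isLatticeForm_realForm (hA : Aᵀ = -A) : IsLatticeForm (integerLattice n) (realForm A) where
  skew x y := by
    rw [PiLp.inner_apply, PiLp.inner_apply]
    simp only [realForm_apply, RCLike.inner_apply, conj_trivial, Finset.mul_sum, Finset.sum_mul]
    rw [Finset.sum_comm, ← Finset.sum_neg_distrib]
    refine Finset.sum_congr rfl fun i _ => ?_
    rw [← Finset.sum_neg_distrib]
    refine Finset.sum_congr rfl fun j _ => ?_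
    have h1 : A j i = -A i j := congrFun (congrFun hA i) j
    rw [h1]
    push_cast
    ring
  integral x hx := by
    apply mem_dualLattice_of_int
    intro i
    choose z hz using hx
    refine ⟨∑ j, A i j * z j, ?_⟩
    rw [realForm_apply]
    push_cast
    exact Finset.sum_congr rfl fun j _ => by rw [hz]

theorem norm_realForm_le {X : ℝ} (hX : 0 ≤ X) (hA : ∀ i j, |(A i j : ℝ)| ≤ X)
    (x : EuclideanSpace ℝ (Fin n)) : ‖realForm A x‖ ≤ (n ^ 2 * X) * ‖x‖ := by
  have h1 : ∀ i, ‖realForm A x i‖ ≤ n * (X * ‖x‖) := by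
    intro i
    rw [realForm_apply]
    refine (norm_sum_le _ _).trans ((Finset.sum_le_card_nsmul _ _ (X * ‖x‖) ?_).trans ?_)
    · intro j _
      rw [norm_mul]
      exact mul_le_mul (hA i j) (PiLp.norm_apply_le x j) (norm_nonneg _) hX
    · simp
  have h2 : realForm A x = ∑ i, realForm A x i • EuclideanSpace.single i (1 : ℝ) := by
    ext j
    simp [Pi.single_apply]
  rw [h2]
  refine (norm_sum_le _ _).trans ((Finset.sum_le_card_nsmul _ _ (n * (X * ‖x‖)) ?_).trans ?_)
  · intro j _
    rw [norm_smul]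
    simpa using h1 j
  · rw [Finset.card_univ, Fintype.card_fin, nsmul_eq_mul]
    apply le_of_eq
    ring

/-- Integer vectors independent over `ℤ` stay independent over `ℝ`. -/
theorem kerRank_le_finrank_ker : kerRank A ≤ finrank ℝ (LinearMap.ker (realForm A)) := by
  obtain ⟨b⟩ : Nonempty (Basis (Fin (kerRank A)) ℤ (LinearMap.ker A.mulVecLin)) :=
    ⟨Module.finBasis ℤ (LinearMap.ker A.mulVecLin)⟩
  have h1 : LinearIndependent ℤ (fun s => (b s : Fin n → ℤ)) :=
    b.linearIndependent.map' (LinearMap.ker A.mulVecLin).subtype (Submodule.ker_subtype _)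
  have h2 := (linearIndependent_algebraMap_comp_iff (R := ℤ) (S := ℝ)).2 h1
  have h3 := h2.map' (WithLp.linearEquiv 2 ℝ (Fin n → ℝ)).symm.toLinearMap (LinearEquiv.ker _)
  have h4 : ∀ s, (WithLp.linearEquiv 2 ℝ (Fin n → ℝ)).symm
      (algebraMap ℤ ℝ ∘ (b s : Fin n → ℤ)) ∈ LinearMap.ker (realForm A) := by
    intro s
    rw [LinearMap.mem_ker]
    ext i
    have h5 := congrFun (LinearMap.mem_ker.1 (b s).2) i
    simp only [mulVecLin_apply, mulVec, dotProduct, Pi.zero_apply] at h5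
    rw [realForm_apply, PiLp.zero_apply]
    have h6 := congrArg (fun z : ℤ => (z : ℝ)) h5
    push_cast at h6
    simpa using h6
  have h5 : LinearIndependent ℝ (fun s => (⟨_, h4 s⟩ : LinearMap.ker (realForm A))) :=
    LinearIndependent.of_comp (LinearMap.ker (realForm A)).subtype h3
  simpa using h5.fintype_card_le_finrank

/-- The upper bound for the number of alternating matrices with large kernel. -/
theorem exists_ncard_kerRank_le (n r k : ℕ) (hr : 1 ≤ r) (hn : n = r + 2 * k) : ∃ C : ℝ, 0 < C ∧
    ∀ X : ℝ, 1 ≤ X → ({A ∈ altMatricesLE n X | r ≤ kerRank A}.ncard : ℝ) ≤ C * X ^ (n * k) := by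
  classical
  -- The threshold 1 is available because nonzero integer vectors have norm at least 1.
  obtain ⟨C, hC, h⟩ := exists_card_forms_le k n 1 one_pos le_rfl
  have hn1 : (1 : ℝ) ≤ n := by exact_mod_cast (by omega : 1 ≤ n)
  refine ⟨C * (3 ^ n) ^ (2 * k) * (n ^ 2) ^ (n * k), by positivity, fun X hX => ?_⟩
  have hX0 : 0 ≤ X := by linarith
  have hfin : {A ∈ altMatricesLE n X | r ≤ kerRank A}.Finite :=
    (altMatricesLE_finite n X).subset (fun A hA => hA.1)
  have h1 := h (EuclideanSpace ℝ (Fin n)) (integerLattice n) (3 ^ n) (n ^ 2 * X)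
    (span_integerLattice n) (by simp) (countBound_dual_integerLattice n)
    (one_le_mul_of_one_le_of_one_le (one_le_pow₀ hn1) hX) (hfin.toFinset.image realForm) (by
      intro T hT
      obtain ⟨A, hA, rfl⟩ := Finset.mem_image.1 hT
      obtain ⟨⟨hAt, hAX⟩, hAr⟩ := (Set.Finite.mem_toFinset _).1 hA
      refine ⟨isLatticeForm_realForm hAt, ?_, norm_realForm_le hX0 hAX,
        fun u hu _ hu0 => one_le_norm_of_mem_dualLattice hu hu0⟩
      have := kerRank_le_finrank_ker (A := A)
      rw [finrank_euclideanSpace, Fintype.card_fin]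
      omega)
  rw [Finset.card_image_of_injective _ realForm_injective, ← Set.ncard_eq_toFinset_card _ hfin,
    mul_pow] at h1
  linarith

end UpperBound

/-! ### Counting all alternating matrices and comparing exponents. -/

section Total

open Matrix

/-- The positions above the diagonal. -/
def upperPairs (n : ℕ) : Finset (Fin n × Fin n) := Finset.univ.filter (fun p => p.1 < p.2)

theorem two_mul_card_upperPairs (n : ℕ) : 2 * (upperPairs n).card + n = n * n := by
  have h1 : (Finset.univ.filter (fun p : Fin n × Fin n => p.2 < p.1)).card =
      (upperPairs n).card := by
    apply Finset.card_bij (fun p _ => p.swap)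
    · intro p hp
      simpa [upperPairs] using hp
    · intro p _ q _ h
      exact Prod.swap_injective h
    · intro p hp
      exact ⟨p.swap, by simpa [upperPairs] using hp, by simp⟩
  have h2 := Finset.offDiag_card (Finset.univ : Finset (Fin n))
  have h3 : (Finset.univ : Finset (Fin n)).offDiag =
      upperPairs n ∪ Finset.univ.filter (fun p : Fin n × Fin n => p.2 < p.1) := by
    ext p
    simp [upperPairs, lt_or_lt_iff_ne]
  rw [h3, Finset.card_union_of_disjoint, h1, Finset.card_univ, Fintype.card_fin] at h2
  · have : n ≤ n * n := Nat.le_mul_self n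
    omega
  · rw [Finset.disjoint_left]
    intro p hp hp'
    simp only [upperPairs, Finset.mem_filter, Finset.mem_univ, true_and] at hp hp'
    exact lt_asymm hp hp'

theorem pow_le_ncard_altMatricesLE (n : ℕ) {X : ℝ} (hX : 1 ≤ X) :
    X ^ (upperPairs n).card ≤ ((altMatricesLE n X).ncard : ℝ) := by
  classical
  set F := Fintype.piFinset (fun _ : upperPairs n => Finset.Icc (-⌊X⌋) ⌊X⌋) with hF
  have hfl : 0 ≤ ⌊X⌋ := Int.floor_nonneg.2 (by linarith)
  let mat : (upperPairs n → ℤ) → Matrix (Fin n) (Fin n) ℤ := fun f => Matrix.of fun i j =>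
    if h : (i, j) ∈ upperPairs n then f ⟨_, h⟩ else
      if h : (j, i) ∈ upperPairs n then -f ⟨_, h⟩ else 0
  have hasym : ∀ i j : Fin n, (i, j) ∈ upperPairs n → (j, i) ∉ upperPairs n := by
    intro i j h h'
    simp only [upperPairs, Finset.mem_filter, Finset.mem_univ, true_and] at h h'
    exact lt_asymm h h'
  have h1 : F.card ≤ (altMatricesLE n X).ncard := by
    rw [← Set.ncard_coe_finset]
    refine Set.ncard_le_ncard_of_injOn mat ?_ ?_ (altMatricesLE_finite n X)
    · intro f hf
      have hf' := Fintype.mem_piFinset.1 (Finset.mem_coe.1 hf)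
      have hb : ∀ q, |(f q : ℝ)| ≤ X := by
        intro q
        have h2 := Finset.mem_Icc.1 (hf' q)
        have h3 : |f q| ≤ ⌊X⌋ := abs_le.2 h2
        have h4 : |(f q : ℝ)| ≤ (⌊X⌋ : ℝ) := by exact_mod_cast h3
        exact h4.trans (Int.floor_le X)
      refine ⟨?_, ?_⟩
      · ext i j
        simp only [transpose_apply, Matrix.neg_apply, mat, of_apply]
        by_cases h : (i, j) ∈ upperPairs n
        · simp [h, hasym i j h]
        · by_cases h' : (j, i) ∈ upperPairs n
          · simp [h, h']
          · simp [h, h']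
      · intro i j
        simp only [mat, of_apply]
        split_ifs with h h'
        · exact hb _
        · rw [Int.cast_neg, abs_neg]; exact hb _
        · simp; linarith
    · intro f _ g _ hfg
      ext ⟨⟨i, j⟩, hq⟩
      have := congrFun (congrFun hfg i) j
      simpa [mat, hq] using this
  have h2 : X ^ (upperPairs n).card ≤ (F.card : ℝ) := by
    rw [hF, Fintype.card_piFinset, Finset.prod_const, Finset.card_univ, Fintype.card_coe,
      Int.card_Icc]
    push_cast
    gcongr
    rw [← Int.cast_natCast, Int.toNat_of_nonneg (by omega)]
    push_cast
    have := Int.lt_floor_add_one X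
    have : (0 : ℝ) ≤ ⌊X⌋ := by exact_mod_cast hfl
    linarith
  exact h2.trans (by exact_mod_cast h1)

theorem ncard_altMatricesLE_le (n : ℕ) {X : ℝ} (hX : 1 ≤ X) :
    ((altMatricesLE n X).ncard : ℝ) ≤ (3 * X) ^ (upperPairs n).card := by
  classical
  set F := Fintype.piFinset (fun _ : upperPairs n => Finset.Icc (-⌊X⌋) ⌊X⌋) with hF
  have hfl : 0 ≤ ⌊X⌋ := Int.floor_nonneg.2 (by linarith)
  have h1 : (altMatricesLE n X).ncard ≤ F.card := by
    rw [← Set.ncard_coe_finset]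
    refine Set.ncard_le_ncard_of_injOn (fun A q => A q.1.1 q.1.2) ?_ ?_ (Finset.finite_toSet _)
    · intro A hA
      refine Finset.mem_coe.2 (Fintype.mem_piFinset.2 fun q => ?_)
      have h2 := abs_le.1 (hA.2 q.1.1 q.1.2)
      rw [Finset.mem_Icc]
      refine ⟨?_, Int.le_floor.2 h2.2⟩
      have : -(A q.1.1 q.1.2) ≤ ⌊X⌋ := Int.le_floor.2 (by push_cast; linarith)
      linarith
    · intro A hA B hB hAB
      have hlt : ∀ i j : Fin n, i < j → A i j = B i j := fun i j hij =>
        congrFun hAB ⟨(i, j), by simpa [upperPairs] using hij⟩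
      have hAt : ∀ i j, A j i = -A i j := fun i j => congrFun (congrFun hA.1 i) j
      have hBt : ∀ i j, B j i = -B i j := fun i j => congrFun (congrFun hB.1 i) j
      ext i j
      rcases lt_trichotomy i j with h | h | h
      · exact hlt i j h
      · subst h
        have := hAt i i
        have := hBt i i
        omega
      · rw [hAt j i, hBt j i, hlt j i h]
  have h2 : (F.card : ℝ) ≤ (3 * X) ^ (upperPairs n).card := by
    rw [hF, Fintype.card_piFinset, Finset.prod_const, Finset.card_univ, Fintype.card_coe,
      Int.card_Icc]
    push_cast
    gcongr
    rw [← Int.cast_natCast, Int.toNat_of_nonneg (by omega)]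
    push_cast
    have := Int.floor_le X
    linarith
  exact le_trans (by exact_mod_cast h1) h2

theorem pow_rpow_eq_div {n r k : ℕ} (hn : n = r + 2 * k) {X : ℝ} (hX : 1 ≤ X) :
    (X ^ n) ^ (-(((r : ℝ) - 1) / 2)) = X ^ (n * k) / X ^ (upperPairs n).card := by
  have hX0 : 0 < X := by linarith
  rw [← Real.rpow_natCast X n, ← Real.rpow_mul hX0.le, ← Real.rpow_natCast, ← Real.rpow_natCast,
    ← Real.rpow_sub hX0]
  congr 1
  have h1 : (2 * (upperPairs n).card + n : ℝ) = n * n := by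
    exact_mod_cast two_mul_card_upperPairs n
  have h2 : (n : ℝ) = r + 2 * k := by exact_mod_cast hn
  push_cast
  have h3 : (r : ℝ) = n - 2 * k := by linarith
  rw [h3]
  linarith

theorem exists_uniformProb_bounds (n k : ℕ) : ∃ c C : ℝ, 0 < c ∧ 0 < C ∧
    ∀ r : ℕ, 1 ≤ r → n = r + 2 * k → ∀ X : ℝ, 1 ≤ X →
      c * (X ^ n) ^ (-(((r : ℝ) - 1) / 2)) ≤
          uniformProb (altMatricesLE n X) (fun A => r ≤ kerRank A) ∧
        uniformProb (altMatricesLE n X) (fun A => r ≤ kerRank A) ≤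
          C * (X ^ n) ^ (-(((r : ℝ) - 1) / 2)) := by
  by_cases hk : 2 * k < n
  · obtain ⟨c, hc, hlow⟩ := exists_le_ncard_kerRank n (n - 2 * k) k (by omega) (by omega)
    obtain ⟨C, hC, hup⟩ := exists_ncard_kerRank_le n (n - 2 * k) k (by omega) (by omega)
    refine ⟨c / 3 ^ (upperPairs n).card, C, by positivity, hC, ?_⟩
    intro r hr hn X hX
    obtain rfl : r = n - 2 * k := by omega
    have hX0 : 0 < X := by linarith
    rw [pow_rpow_eq_div hn hX]
    have h1 := pow_le_ncard_altMatricesLE n hX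
    have h2 := ncard_altMatricesLE_le n hX
    have hpos : (0 : ℝ) < (altMatricesLE n X).ncard := lt_of_lt_of_le (by positivity) h1
    unfold uniformProb
    constructor
    · rw [mul_pow] at h2
      calc c / 3 ^ (upperPairs n).card * (X ^ (n * k) / X ^ (upperPairs n).card)
          = c * X ^ (n * k) / (3 ^ (upperPairs n).card * X ^ (upperPairs n).card) := by
            rw [div_mul_div_comm]
        _ ≤ _ := div_le_div₀ (Nat.cast_nonneg _) (hlow X hX) hpos h2
    · rw [← mul_div_assoc]
      exact div_le_div₀ (by positivity) (hup X hX) (by positivity) h1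
  -- No `r ≥ 1` corresponds to this `k`, so the constants are arbitrary.
  · exact ⟨1, 1, one_pos, one_pos, fun r hr hn => absurd hn (by omega)⟩

end Total

theorem mainTheorem1 (n : ℕ) :
    ∃ c C : ℝ, 0 < c ∧ 0 < C ∧
      ∀ r : ℕ, 1 ≤ r → r ≤ n → Even (n - r) →
        ∀ X : ℝ, 1 ≤ X →
          c * (X ^ n) ^ (-(((r : ℝ) - 1) / 2)) ≤
              uniformProb (altMatricesLE n X) (fun A => r ≤ kerRank A) ∧
            uniformProb (altMatricesLE n X) (fun A => r ≤ kerRank A) ≤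
              C * (X ^ n) ^ (-(((r : ℝ) - 1) / 2)) := by
  choose c C hc hC h using exists_uniformProb_bounds n
  have hne : (Finset.range (n + 1)).Nonempty := Finset.nonempty_range_add_one
  -- The constants depend on `k = (n - r) / 2`, which takes finitely many values; the extremes over
  -- `k ≤ n` serve every `r`.
  refine ⟨(Finset.range (n + 1)).inf' hne c, (Finset.range (n + 1)).sup' hne C,
    (Finset.lt_inf'_iff _).2 fun k _ => hc k,
    (hC 0).trans_le (Finset.le_sup' C (Finset.mem_range.2 n.succ_pos)), ?_⟩
  intro r hr hrn hev X hX
  obtain ⟨k, hk⟩ := hev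
  have hkn : k ∈ Finset.range (n + 1) := Finset.mem_range.2 (by omega)
  have hX0 : 0 ≤ X := by linarith
  have hpos : 0 ≤ (X ^ n) ^ (-(((r : ℝ) - 1) / 2)) := Real.rpow_nonneg (pow_nonneg hX0 n) _
  obtain ⟨h1, h2⟩ := h k r hr (by omega) X hX
  exact ⟨(mul_le_mul_of_nonneg_right (Finset.inf'_le c hkn) hpos).trans h1,
    h2.trans (mul_le_mul_of_nonneg_right (Finset.le_sup' C hkn) hpos)⟩
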